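/- Let $\Gamma$ be a finite connected graph without loops (multiple edges allowed), 2-cell embedded in a closed surface (orientable or not), such that every vertex has even degree greater than $2$. Let $e=|E(\Gamma)|$, let $\chi=|V(\Gamma)|-|E(\Gamma)|+|F(\Gamma)|$ be the Euler characteristic, and let $\delta=1$ if the dual graph $\Gamma^\ast$ is bipartite and $\delta=0$ otherwise. Let $\Gamma_2$ be the 2-colex (3-valent embedded graph with properly 3-coloured faces) obtained from $\Gamma$ by splitting every edge into two parallel edges bounding a new face and then expanding every vertex of degree $d$ into a face with $2d$ sides. Its faces are called $v$-, $e$- or $f$-faces, according to whether they come from a vertex, an edge or a face of $\Gamma$. Let $\Gamma_h$ be the hypergraph obtained from $\Gamma_2$ as follows: inside every $v$-face $g$ (with $2d$ sides) place a new face $g'$ with $d$ sides, and promote each of the $d$ edges that separate $g$ from an $e$-face to a rank-3 edge by adding to it one vertex of $g'$, in the cyclic order around $g$, so that the rank-3 edges do not cross; all other edges of $\Gamma_2$, and the edges of the faces $g'$, are rank-2 edges of $\Gamma_h$. Then $\Gamma_h$ has a proper edge colouring by the three Pauli matrices $X,Y,Z$ in which all rank-3 edges are coloured $Z$. Fix any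 such colouring, put a qubit on every vertex of $\Gamma_h$, and let $\mathcal G$ be the subgroup of the Pauli group generated by the phases, by $P_uP_v$ for every rank-2 edge $\{u,v\}$ of colour $P$, and by $Z_uZ_v, Z_vZ_w, Z_wZ_u$ for every rank-3 edge $\{u,v,w\}$. Let $C(\cdot)$ denote the centralizer in the Pauli group, let $S=\mathcal G\cap C(\mathcal G)$, and let $\dim$ denote $\log_2$ of the order of a subgroup modulo phases. Then the 2-local subsystem code with gauge group $\mathcal G$ has parameters $$[[\,6e,\ 1+\delta-\chi,\ 4e-\chi,\ d\le \ell\,]].$$ That is, with $n=6e$, $k=1+\delta-\chi\ge 0$ and $r=4e-\chi\ge 0$, the code has $n$ qubits and there is $s\ge 0$ with $n=k+r+s$, $\dim S=s$, $\dim\mathcal G=2r+s$ and $\dim C(\mathcal G)=2k+s$; and its distance $d=\min\{\operatorname{wt}(p): p\in C(S)\setminus\mathcal G\}$ satisfies $d\le\ell$ whenever $\ell$ is the number of rank-3 edges of a homologically nontrivial hypercycle. Here a hypercycle is a set $\sigma$ of edges of $\Gamma_h$ such that every vertex lies on an even number of them; its operator $W(\sigma)$ is the product over $\sigma$ of $P_uP_v$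 for the rank-2 edges $\{u,v\}$ of colour $P$ and $Z_uZ_vZ_w$ for the rank-3 edges; and $\sigma$ is called homologically nontrivial if $W(\sigma)\notin S$. (If $k=0$ there is no such hypercycle, and the bound is empty.) -/

import Mathlib

/-! ## Graphs embedded in closed surfaces -/

/-- A connected graph with a 2-cell embedding in a closed surface (orientable or not), presented by
its finite set of flags.  A flag is a side of a half-edge, i.e. a triple consisting of a
vertex, an end of an edge at that vertex, and one of the two sides of that edge.
`t0` moves to the other end of the edge, `t1` crosses the corner of the face to the next edge end at
the vertex, and `t2` moves to the other side of the edge.  Multiple edges and loops are allowed. -/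
structure EmbeddedGraph (Φ : Type*) where
  t0 : Φ → Φ
  t1 : Φ → Φ
  t2 : Φ → Φ
  invol0 : Function.Involutive t0
  invol1 : Function.Involutive t1
  invol2 : Function.Involutive t2
  ne0 : ∀ φ, t0 φ ≠ φ
  ne1 : ∀ φ, t1 φ ≠ φ
  ne2 : ∀ φ, t2 φ ≠ φ
  comm02 : ∀ φ, t0 (t2 φ) = t2 (t0 φ)
  ne02 : ∀ φ, t0 φ ≠ t2 φ
  nonempty : Nonempty Φ
  connected : ∀ φ ψ, Relation.ReflTransGen (fun a b => b = t0 a ∨ b = t1 a ∨ b = t2 a) φ ψ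

namespace EmbeddedGraph

variable {Φ : Type*} (Γ : EmbeddedGraph Φ)

/-- Vertices: orbits of flags under `t1`, `t2`. -/
def Vertex : Type _ := Quot (fun a b : Φ => b = Γ.t1 a ∨ b = Γ.t2 a)

/-- Edges: orbits of flags under `t0`, `t2`. -/
def Edge : Type _ := Quot (fun a b : Φ => b = Γ.t0 a ∨ b = Γ.t2 a)

/-- Faces: orbits of flags under `t0`, `t1`. -/
def Face : Type _ := Quot (fun a b : Φ => b = Γ.t0 a ∨ b = Γ.t1 a)

/-- Edge ends (half-edges): orbits of flags under `t2`. -/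
def EdgeEnd : Type _ := Quot (fun a b : Φ => b = Γ.t2 a)

/-- The vertex of a flag. -/
def vertex (φ : Φ) : Γ.Vertex := Quot.mk _ φ

/-- The edge end of a flag. -/
def edgeEnd (φ : Φ) : Γ.EdgeEnd := Quot.mk _ φ

/-- The degree of a vertex is the number of edge ends at it. -/
noncomputable def degree (v : Γ.Vertex) : ℕ := (Γ.edgeEnd '' {φ | Γ.vertex φ = v}).ncard

/-- No edge joins a vertex to itself. -/
def Loopless : Prop := ∀ φ, Γ.vertex φ ≠ Γ.vertex (Γ.t0 φ)

/-- The vertices can be 2-coloured so that the two ends of every edge have different colours. -/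
def IsBipartite : Prop := ∃ κ : Γ.Vertex → Bool, ∀ φ, κ (Γ.vertex φ) ≠ κ (Γ.vertex (Γ.t0 φ))

/-- The dual graph, embedded in the same surface. -/
def dual : EmbeddedGraph Φ where
  t0 := Γ.t2
  t1 := Γ.t1
  t2 := Γ.t0
  invol0 := Γ.invol2
  invol1 := Γ.invol1
  invol2 := Γ.invol0
  ne0 := Γ.ne2
  ne1 := Γ.ne1
  ne2 := Γ.ne0
  comm02 := fun φ => (Γ.comm02 φ).symm
  ne02 := fun φ => (Γ.ne02 φ).symm
  nonempty := Γ.nonempty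
  connected := fun φ ψ => (Γ.connected φ ψ).lift id (fun _ _ h => h.elim
    (fun h => Or.inr (Or.inr h)) (fun h => h.elim (fun h => Or.inr (Or.inl h)) Or.inl))

/-- The number of edges. -/
noncomputable def numEdges : ℕ := Nat.card Γ.Edge

/-- The Euler characteristic `|V| - |E| + |F|`. -/
noncomputable def eulerChar : ℤ :=
  (Nat.card Γ.Vertex : ℤ) - (Nat.card Γ.Edge : ℤ) + (Nat.card Γ.Face : ℤ)

open Classical in
/-- `1` if the dual graph is bipartite and `0` otherwise. -/
noncomputable def dualBipartiteIndicator : ℤ := if Γ.dual.IsBipartite then 1 else 0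

end EmbeddedGraph

/-! ## 2-colexes and the insertion of rank-3 edges -/

/-- A 2-colex with vertex set `V`: a 3-valent embedded graph whose faces are properly 3-coloured.
Give each edge the colour of the two faces that it joins, which is the colour missing on the two
faces it borders.  Then each vertex `a` lies on exactly one edge of each colour `i`, with other
end `adj i a`, and the faces of colour `c` are the cycles formed by the edges of the two
colours different from `c`. -/
structure TwoColex (V : Type*) where
  adj : Fin 3 → V → V
  invol : ∀ i, Function.Involutive (adj i)
  ne : ∀ i a, adj i a ≠ a

/-- The 2-colex of an embedded graph: split each edge into a 4-sided face (`e`-face), and expand each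
vertex of degree `d` into a face with `2d` sides (`v`-face).  Its vertices are the flags.
The `v`-faces are bounded by edges of the
types `t1`, `t2`, the `e`-faces by `t0`, `t2`, and the `f`-faces by `t0`, `t1`; so the `v`-faces,
`e`-faces and `f`-faces have the colours `0`, `1`, `2`. -/
def EmbeddedGraph.toColex {Φ : Type*} (Γ : EmbeddedGraph Φ) : TwoColex Φ where
  adj := ![Γ.t0, Γ.t1, Γ.t2]
  invol := by
    intro i
    fin_cases i
    exacts [Γ.invol0, Γ.invol1, Γ.invol2]
  ne := by
    intro i
    fin_cases i
    exacts [Γ.ne0, Γ.ne1, Γ.ne2]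

namespace TwoColex

variable {V : Type*} (C : TwoColex V)

/-- The edges of colour `p`. -/
def EdgeOf (p : Fin 3) : Type _ := Quot (fun a b : V => b = C.adj p a)

/-- The edge of colour `p` at the vertex `a`. -/
def edgeOf (p : Fin 3) (a : V) : C.EdgeOf p := Quot.mk _ a

/-- Insertion of rank-3 edges in all faces of colour `c` of a 2-colex, promoting the edges of colour
`p ≠ c`.  Inside each face `f` of colour `c` lies a new face `f'` having one vertex for each edge of
colour `p` on the boundary of `f`; that edge becomes a rank-3 edge by adding this
vertex.  Going round `f`, consecutive edges of colour `p` are joined by an edge of the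
remaining colour, and the corresponding two vertices of `f'` are joined by an edge of `f'`.
The edges of the two colours other than `p` stay as rank-2 edges. -/
def insertRankThree (c p : Fin 3) : Hypergraph (V ⊕ C.EdgeOf p) where
  vertexSet := Set.univ
  edgeSet :=
    {s | ∃ i a, i ≠ p ∧ s = {Sum.inl a, Sum.inl (C.adj i a)}} ∪
    {s | ∃ a, s = {Sum.inl a, Sum.inl (C.adj p a), Sum.inr (C.edgeOf p a)}} ∪
    {s | ∃ i a, i ≠ p ∧ i ≠ c ∧
      s = {Sum.inr (C.edgeOf p a), Sum.inr (C.edgeOf p (C.adj i a))}}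
  subset_vertexSet_of_mem_edgeSet' := fun _ _ => Set.subset_univ _

instance (p : Fin 3) [Finite V] : Finite (C.EdgeOf p) := by
  unfold EdgeOf
  infer_instance

end TwoColex

/-! ## Pauli operators -/

/-- The one-qubit Pauli matrices. -/
inductive PauliLetter where
  | I | X | Y | Z
  deriving DecidableEq

namespace PauliLetter

instance : Fintype PauliLetter := ⟨{I, X, Y, Z}, fun p => by cases p <;> decide⟩

/-- The product of two Pauli matrices up to a phase. -/
def mul : PauliLetter → PauliLetter → PauliLetter
  | I, q => q
  | p, I => p
  | X, X => I
  | X, Y => Z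
  | X, Z => Y
  | Y, X => Z
  | Y, Y => I
  | Y, Z => X
  | Z, X => Y
  | Z, Y => X
  | Z, Z => I

/-- The exponent `m` with `p q = i ^ m (mul p q)` as matrices: `XY = iZ`, `YZ = iX`, `ZX = iY`,
`YX = -iZ`, `ZY = -iX`, `XZ = -iY`. -/
def phase : PauliLetter → PauliLetter → ZMod 4
  | X, Y => 1
  | Y, Z => 1
  | Z, X => 1
  | Y, X => 3
  | Z, Y => 3
  | X, Z => 3
  | _, _ => 0

theorem mul_assoc' : ∀ p q r : PauliLetter, mul (mul p q) r = mul p (mul q r) := by decide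

theorem phase_assoc : ∀ p q r : PauliLetter,
    phase p q + phase (mul p q) r = phase q r + phase p (mul q r) := by decide

theorem mul_self : ∀ p : PauliLetter, mul p p = I := by decide

theorem phase_self : ∀ p : PauliLetter, phase p p = 0 := by decide

theorem I_mul : ∀ p : PauliLetter, mul I p = p := by decide

theorem mul_I : ∀ p : PauliLetter, mul p I = p := by decide

theorem phase_I_left : ∀ p : PauliLetter, phase I p = 0 := by decide

theorem phase_I_right : ∀ p : PauliLetter, phase p I = 0 := by decide

end PauliLetter

/-- A Pauli operator on qubits labelled by `V`: `i ^ phase` times the tensor product over `v` of the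
Pauli matrices `word v`. -/
@[ext]
structure Pauli (V : Type*) where
  phase : ZMod 4
  word : V → PauliLetter

namespace Pauli

variable {V : Type*}

/-- The Pauli group, with the multiplication of operators. -/
instance [Fintype V] : Group (Pauli V) where
  mul p q := ⟨p.phase + q.phase + ∑ v, PauliLetter.phase (p.word v) (q.word v),
    fun v => PauliLetter.mul (p.word v) (q.word v)⟩
  one := ⟨0, fun _ => PauliLetter.I⟩
  inv p := ⟨-p.phase, p.word⟩
  mul_assoc p q r := by
    refine Pauli.ext ?_ (funext fun v => PauliLetter.mul_assoc' _ _ _)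
    change p.phase + q.phase + (∑ v, PauliLetter.phase (p.word v) (q.word v)) + r.phase +
        (∑ v, PauliLetter.phase (PauliLetter.mul (p.word v) (q.word v)) (r.word v)) =
      p.phase + (q.phase + r.phase + ∑ v, PauliLetter.phase (q.word v) (r.word v)) +
        ∑ v, PauliLetter.phase (p.word v) (PauliLetter.mul (q.word v) (r.word v))
    have h := Finset.sum_congr (rfl : (Finset.univ : Finset V) = Finset.univ)
      (fun v _ => PauliLetter.phase_assoc (p.word v) (q.word v) (r.word v))
    rw [Finset.sum_add_distrib, Finset.sum_add_distrib] at h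
    linear_combination h
  one_mul p := by
    refine Pauli.ext ?_ (funext fun v => PauliLetter.I_mul _)
    change (0 : ZMod 4) + p.phase + ∑ v, PauliLetter.phase PauliLetter.I (p.word v) = p.phase
    simp [PauliLetter.phase_I_left]
  mul_one p := by
    refine Pauli.ext ?_ (funext fun v => PauliLetter.mul_I _)
    change p.phase + (0 : ZMod 4) + ∑ v, PauliLetter.phase (p.word v) PauliLetter.I = p.phase
    simp [PauliLetter.phase_I_right]
  inv_mul_cancel p := by
    refine Pauli.ext ?_ (funext fun v => PauliLetter.mul_self _)
    change -p.phase + p.phase + ∑ v, PauliLetter.phase (p.word v) (p.word v) = 0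
    simp [PauliLetter.phase_self]

/-- The scalar operator `i`. -/
def scalarI : Pauli V := ⟨1, fun _ => PauliLetter.I⟩

open Classical in
/-- The Pauli matrix `P` on every qubit of `s`, the identity on the others. -/
noncomputable def on (P : PauliLetter) (s : Set V) : Pauli V :=
  ⟨0, fun v => if v ∈ s then P else PauliLetter.I⟩

/-- The number of qubits on which an operator acts nontrivially. -/
noncomputable def weight (p : Pauli V) : ℕ := {v | p.word v ≠ PauliLetter.I}.ncard

end Pauli

/-! ## Subsystem codes -/

namespace SubsystemCode

variable {V : Type*} [Fintype V]

/-- The centralizer `C(G)` in the Pauli group. -/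
def centralizer (G : Subgroup (Pauli V)) : Subgroup (Pauli V) :=
  Subgroup.centralizer (G : Set (Pauli V))

/-- The centre `Z(G)` of the gauge group, which is the stabilizer up to phases. -/
def stabilizer (G : Subgroup (Pauli V)) : Subgroup (Pauli V) := G ⊓ centralizer G

/-- `H` has dimension `m`: up to phases, `H` has exactly `2 ^ m` elements. -/
def HasDim (H : Subgroup (Pauli V)) (m : ℕ) : Prop :=
  (Pauli.word '' (H : Set (Pauli V))).ncard = 2 ^ m

/-- The gauge group `G` (which contains all phases) defines a subsystem code with `n` physical
qubits, `k` encoded qubits and `r` gauge qubits. -/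
def HasParameters (G : Subgroup (Pauli V)) (n k r : ℕ) : Prop :=
  Pauli.scalarI ∈ G ∧ n = Fintype.card V ∧
    ∃ s : ℕ, n = k + r + s ∧ HasDim (stabilizer G) s ∧ HasDim G (2 * r + s) ∧
      HasDim (centralizer G) (2 * k + s)

/-- The minimum weight of an element of `C(Z(G))` outside `G`
(`⊤` if there is no such element, i.e. if no qubit is encoded). -/
noncomputable def distance (G : Subgroup (Pauli V)) : ℕ∞ :=
  ⨅ p ∈ {p : Pauli V | p ∈ centralizer (stabilizer G) ∧ p ∉ G}, (p.weight : ℕ∞)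

/-- Up to phases, `G` is generated by operators acting on two qubits. -/
def IsTwoLocal (G : Subgroup (Pauli V)) : Prop :=
  ∃ A : Set (Pauli V), (∀ p ∈ A, p.weight = 2) ∧ G = Subgroup.closure (insert Pauli.scalarI A)

end SubsystemCode

/-! ## The subsystem code of a 3-valent hypergraph -/

namespace Hypergraph

variable {V : Type*} (H : Hypergraph V)

/-- A proper 3-edge-colouring of `H` by the Pauli matrices `X`, `Y`, `Z` in which all
rank-3 edges are coloured `Z`. -/
def IsLinkColouring (col : Set V → PauliLetter) : Prop :=
  (∀ e ∈ H.edgeSet, col e ≠ PauliLetter.I) ∧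
  (∀ e ∈ H.edgeSet, e.ncard = 3 → col e = PauliLetter.Z) ∧
  (∀ e ∈ H.edgeSet, ∀ e' ∈ H.edgeSet, e ≠ e' → (e ∩ e').Nonempty → col e ≠ col e')

variable [Fintype V]

/-- The gauge group, generated (with the phases) by the two-qubit link operators: `XX`, `YY` or `ZZ` on
each rank-2 edge, according to its colour, and `ZZ` on each of the three pairs of vertices of a rank-3
edge. -/
noncomputable def gaugeGroup (col : Set V → PauliLetter) : Subgroup (Pauli V) :=
  Subgroup.closure (insert Pauli.scalarI
    {p | ∃ e ∈ H.edgeSet, ∃ u ∈ e, ∃ v ∈ e, u ≠ v ∧ p = Pauli.on (col e) {u, v}})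

/-- A hypercycle: a set of edges such that every vertex lies on an even number of them. -/
def IsHypercycle (σ : Set (Set V)) : Prop :=
  σ ⊆ H.edgeSet ∧ ∀ v, Even {e ∈ σ | v ∈ e}.ncard

/-- The cycle operator of `σ`: the product over the edges `e ∈ σ` of the operators `XX`, `YY`, `ZZ`
(rank 2) and `ZZZ` (rank 3) on `e`.  The order of the factors only affects the phase. -/
noncomputable def cycleOperator (col : Set V → PauliLetter) (σ : Set (Set V)) : Pauli V :=
  ((Set.toFinite σ).toFinset.toList.map (fun e => Pauli.on (col e) e)).prod

/-- A hypercycle whose operator is not in the stabilizer. -/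
def IsNontrivialHypercycle (col : Set V → PauliLetter) (σ : Set (Set V)) : Prop :=
  H.IsHypercycle σ ∧ cycleOperator col σ ∉ SubsystemCode.stabilizer (H.gaugeGroup col)

end Hypergraph

/-- The hypergraph obtained from the 2-colex of `Γ` by inserting rank-3 edges in all `v`-faces, in such
a way that they are on the boundaries of the `e`-faces: the promoted edges are those between a `v`-face
and an `e`-face, which have the colour of the `f`-faces. -/
def EmbeddedGraph.subsystemHypergraph {Φ : Type*} (Γ : EmbeddedGraph Φ) :
    Hypergraph (Φ ⊕ Γ.toColex.EdgeOf 2) :=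
  Γ.toColex.insertRankThree 0 2

noncomputable instance {Φ : Type*} [Finite Φ] (Γ : EmbeddedGraph Φ) :
    Fintype (Φ ⊕ Γ.toColex.EdgeOf 2) :=
  Fintype.ofFinite _

/-!
Multiplying Pauli operators up to phases is addition in a symplectic space over `𝔽₂`, in which the
centralizer of a subgroup is its symplectic orthogonal complement
(`SubsystemCode.space_centralizer`).  So all parameters follow from the dimensions of `C(𝒢)` and of
`S = 𝒢 ∩ C(𝒢)`, the radical of the symplectic form on `C(𝒢)`.

An operator commutes with all link operators if and only if, for every edge, it commutes with the matrix of
that edge at all vertices of the edge or at none.  The edges at whose vertices it anticommutes form a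
hypercycle, and every hypercycle arises from exactly one operator up to a phase.  On flags this becomes
a pair `(s, g)`: `s` is the indicator of the `t0`-edges and `g` that of the edges of the inserted faces,
indexed by corners.  Evenness at the vertices determines the rank-3 edges, `g + g ∘ t2`, and the
`t1`-edges, `s + g + g ∘ t2`, and the only remaining condition is that `s + g ∘ t2` be invariant under
`t1`.  This identifies `C(𝒢)` with `EmbeddedGraph.cycleSpace`
(`EmbeddedGraph.map_cycleVec_cycleSpace`), and the symplectic form with the parity of the number of
common rank-3 edges, which equals `∑ g (g' ∘ t2)` over the flags
(`EmbeddedGraph.symplecticForm_cycleVec`).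

No walk along faces is needed for the dimensions.  The functions on flags invariant under a
fixed-point-free involution form a Lagrangian subspace for the standard form
(`orthogonal_invariants`), so the orthogonal complement of the space `I₁ ∩ t2 (I₀ + I₁)` of all
possible `g` is `I₁ + t2 (I₀ ∩ I₁)`, and the radical consists of the `g` in
`(I₀ ∩ I₁) + (I₁ ∩ t2 I₁)`.  Here `I₀ ∩ I₁` has dimension `|F|`, a 2-colouring of the corners
alternating around the vertices gives `I₁ ∩ t2 I₁` dimension `2 |V|`, and the spaces intersect in
`EmbeddedGraph.faceColourings`, whose dimension is `1 + δ`: it consists of the constants and, if the dual is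
bipartite, the proper 2-colourings of the faces.  Such a 2-colouring of the corners exists because
the degrees are even (`EmbeddedGraph.exists_corner_colouring`), and it also colours the edges of the
inserted faces.

For the distance, the operator of a nontrivial hypercycle lies in `C(𝒢)` but not in `𝒢`.  Multiplying
it by link operators removes its rank-2 edges and reduces each rank-3 edge to a single `Z` at the vertex of
the inserted face.  The result is in `C(S)`, outside `𝒢`, and its weight is the number of rank-3 edges.
-/

/-! ### Functions on flags invariant under fixed-point-free involutions -/

section Invariants

variable {Φ : Type*}

/-- The `𝔽₂`-valued functions on `Φ` invariant under `t`. -/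
def invariants (t : Φ → Φ) : Submodule (ZMod 2) (Φ → ZMod 2) where
  carrier := {f | ∀ a, f (t a) = f a}
  add_mem' hf hg a := by simp only [Pi.add_apply, hf a, hg a]
  zero_mem' _ := rfl
  smul_mem' c f hf a := by simp only [Pi.smul_apply, hf a]

/-- Precomposition with `t`. -/
def pullback (t : Φ → Φ) : (Φ → ZMod 2) →ₗ[ZMod 2] (Φ → ZMod 2) :=
  LinearMap.funLeft (ZMod 2) (ZMod 2) t

@[simp]
theorem pullback_apply (t : Φ → Φ) (f : Φ → ZMod 2) (a : Φ) : pullback t f a = f (t a) := rfl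

theorem pullback_pullback {t : Φ → Φ} (ht : Function.Involutive t) (f : Φ → ZMod 2) :
    pullback t (pullback t f) = f := by
  ext a
  simp [ht a]

/-- Functions constant on the classes of a relation are functions on the quotient. -/
theorem finrank_eq_card_quot [Finite Φ] (r : Φ → Φ → Prop) (W : Submodule (ZMod 2) (Φ → ZMod 2))
    (hW : ∀ f, f ∈ W ↔ ∀ a b, r a b → f a = f b) :
    Module.finrank (ZMod 2) W = Nat.card (Quot r) := by
  have hrange : W = LinearMap.range (LinearMap.funLeft (ZMod 2) (ZMod 2) (Quot.mk r)) := by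
    ext f
    rw [hW, LinearMap.mem_range]
    constructor
    · intro h
      exact ⟨Quot.lift f h, rfl⟩
    · rintro ⟨g, rfl⟩ a b hab
      exact congrArg g (Quot.sound hab)
  have : Fintype (Quot r) := Fintype.ofFinite _
  rw [hrange, LinearMap.finrank_range_of_inj
    (LinearMap.funLeft_injective_of_surjective _ _ _ Quot.mk_surjective),
    Module.finrank_fintype_fun_eq_card, Nat.card_eq_fintype_card]

theorem finrank_comap_pullback {t : Φ → Φ} (ht : Function.Involutive t)
    (W : Submodule (ZMod 2) (Φ → ZMod 2)) :
    Module.finrank (ZMod 2) (W.comap (pullback t)) = Module.finrank (ZMod 2) W := by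
  have h := LinearEquiv.finrank_map_eq (LinearEquiv.ofInvolutive (pullback t) (pullback_pullback ht))
    (W.comap (pullback t))
  rw [← h]
  suffices hmap : (W.comap (pullback t)).map
      (LinearEquiv.ofInvolutive (pullback t) (pullback_pullback ht) :
        (Φ → ZMod 2) →ₗ[ZMod 2] (Φ → ZMod 2)) = W by rw [hmap]
  ext f
  simp only [Submodule.mem_map, Submodule.mem_comap]
  constructor
  · rintro ⟨y, hy, rfl⟩
    exact hy
  · intro hf
    exact ⟨pullback t f, by rwa [pullback_pullback ht], pullback_pullback ht f⟩

/-- In characteristic 2, an invariant function sums to zero over a fixed-point-free involution. -/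
theorem sum_eq_zero_of_mem_invariants [Fintype Φ] {t : Φ → Φ} (ht : Function.Involutive t)
    (hne : ∀ a, t a ≠ a) {f : Φ → ZMod 2} (hf : f ∈ invariants t) : ∑ a, f a = 0 :=
  Finset.sum_involution (fun a _ => t a) (fun a _ => by rw [hf a, CharTwo.add_self_eq_zero])
    (fun a _ _ => hne a) (fun _ _ => Finset.mem_univ _) (fun a _ => ht a)

theorem add_self_eq_zero_fun (f : Φ → ZMod 2) : f + f = 0 :=
  funext fun _ => CharTwo.add_self_eq_zero _

theorem mul_mem_invariants {t : Φ → Φ} {f g : Φ → ZMod 2} (hf : f ∈ invariants t)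
    (hg : g ∈ invariants t) : f * g ∈ invariants t := fun a => by
  simp only [Pi.mul_apply, hf a, hg a]

variable [Fintype Φ]

/-- The standard bilinear form on `𝔽₂`-valued functions. -/
def pairing (Φ : Type*) [Fintype Φ] : LinearMap.BilinForm (ZMod 2) (Φ → ZMod 2) :=
  dotProductBilin (ZMod 2) (ZMod 2)

theorem pairing_apply (f g : Φ → ZMod 2) : pairing Φ f g = ∑ a, f a * g a := rfl

theorem pairing_comm (f g : Φ → ZMod 2) : pairing Φ f g = pairing Φ g f := by
  simp only [pairing_apply, mul_comm]

theorem pairing_isRefl : (pairing Φ).IsRefl := fun f g h => by rwa [pairing_comm]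

theorem pairing_nondegenerate : (pairing Φ).Nondegenerate := by
  classical
  have h : ∀ f : Φ → ZMod 2, (∀ g, pairing Φ f g = 0) → f = 0 := by
    intro f hf
    ext a
    simpa [pairing_apply, Pi.single_apply] using hf (Pi.single a 1)
  exact ⟨h, fun g hg => h g fun f => by rw [pairing_comm]; exact hg f⟩

theorem pairing_pullback {t : Φ → Φ} (ht : Function.Involutive t) (f g : Φ → ZMod 2) :
    pairing Φ (pullback t f) g = pairing Φ f (pullback t g) := by
  simp only [pairing_apply, pullback_apply]
  exact Fintype.sum_equiv ht.toPerm _ _ (fun a => by simp [ht a])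

theorem orthogonal_comap_pullback {t : Φ → Φ} (ht : Function.Involutive t)
    (W : Submodule (ZMod 2) (Φ → ZMod 2)) :
    (pairing Φ).orthogonal (W.comap (pullback t)) =
      ((pairing Φ).orthogonal W).comap (pullback t) := by
  ext f
  simp only [LinearMap.BilinForm.mem_orthogonal_iff, Submodule.mem_comap]
  constructor
  · intro h g hg
    rw [← pairing_pullback ht]
    exact h _ (by rwa [pullback_pullback ht])
  · intro h g hg
    have := h _ hg
    rwa [pairing_pullback ht, pullback_pullback ht] at this

theorem orthogonal_sup (U W : Submodule (ZMod 2) (Φ → ZMod 2)) :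
    (pairing Φ).orthogonal (U ⊔ W) = (pairing Φ).orthogonal U ⊓ (pairing Φ).orthogonal W := by
  apply le_antisymm
  · exact le_inf (LinearMap.BilinForm.orthogonal_le le_sup_left)
      (LinearMap.BilinForm.orthogonal_le le_sup_right)
  · rintro f ⟨hU, hW⟩ g hg
    obtain ⟨u, hu, w, hw, rfl⟩ := Submodule.mem_sup.1 hg
    have h1 : pairing Φ u f = 0 := hU u hu
    have h2 : pairing Φ w f = 0 := hW w hw
    change pairing Φ (u + w) f = 0
    rw [map_add, LinearMap.add_apply, h1, h2, add_zero]

theorem orthogonal_inf (U W : Submodule (ZMod 2) (Φ → ZMod 2)) :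
    (pairing Φ).orthogonal (U ⊓ W) = (pairing Φ).orthogonal U ⊔ (pairing Φ).orthogonal W := by
  have hoo := LinearMap.BilinForm.orthogonal_orthogonal (B := pairing Φ) pairing_nondegenerate
    pairing_isRefl
  rw [← hoo ((pairing Φ).orthogonal U ⊔ (pairing Φ).orthogonal W), orthogonal_sup, hoo, hoo]

/-- The invariants of a fixed-point-free involution form a Lagrangian subspace. -/
theorem orthogonal_invariants {t : Φ → Φ} (ht : Function.Involutive t) (hne : ∀ a, t a ≠ a) :
    (pairing Φ).orthogonal (invariants t) = invariants t := by
  classical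
  apply le_antisymm
  · intro f hf a
    have h : pairing Φ (Pi.single a 1 + Pi.single (t a) 1) f = 0 := by
      refine hf _ fun b => ?_
      have h1 : t b = a ↔ b = t a := ht.eq_iff
      have h2 : t b = t a ↔ b = a := ht.injective.eq_iff
      simp only [Pi.add_apply, Pi.single_apply, h1, h2]
      exact add_comm _ _
    simp only [map_add, LinearMap.add_apply, pairing_apply, Pi.single_apply, ite_mul, one_mul,
      zero_mul, Finset.sum_ite_eq', Finset.mem_univ, if_true] at h
    exact (CharTwo.add_eq_zero.1 h).symm
  · intro f hf g hg
    exact sum_eq_zero_of_mem_invariants ht hne (mul_mem_invariants hg hf)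

theorem finrank_add_finrank_pairing_orthogonal (W : Submodule (ZMod 2) (Φ → ZMod 2)) :
    Module.finrank (ZMod 2) W + Module.finrank (ZMod 2) ((pairing Φ).orthogonal W) =
      Fintype.card Φ := by
  have h := LinearMap.BilinForm.finrank_orthogonal (B := pairing Φ) pairing_nondegenerate W
  have hle := Submodule.finrank_le W
  rw [Module.finrank_fintype_fun_eq_card] at h hle
  omega

theorem two_mul_finrank_invariants {t : Φ → Φ} (ht : Function.Involutive t) (hne : ∀ a, t a ≠ a) :
    2 * Module.finrank (ZMod 2) (invariants t) = Fintype.card Φ := by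
  have h := finrank_add_finrank_pairing_orthogonal (invariants t)
  rw [orthogonal_invariants ht hne] at h
  omega

end Invariants

/-! ### Subspaces of flag functions of an embedded graph -/

namespace EmbeddedGraph

variable {Φ : Type*} (Γ : EmbeddedGraph Φ)

theorem card_eq_four_mul_numEdges [Fintype Φ] : Fintype.card Φ = 4 * Γ.numEdges := by
  classical
  set orbit : Φ → Finset Φ := fun a => {a, Γ.t0 a, Γ.t2 a, Γ.t0 (Γ.t2 a)} with horbit
  have h00 := Γ.invol0
  have h22 := Γ.invol2
  have hcard : ∀ a, (orbit a).card = 4 := by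
    intro a
    have h1 := Γ.ne0 a
    have h2 := Γ.ne2 a
    have h3 := Γ.ne02 a
    have h4 : Γ.t0 (Γ.t2 a) ≠ a := fun h => h3 (by rw [← h00 (Γ.t2 a), h])
    have h5 : Γ.t0 (Γ.t2 a) ≠ Γ.t0 a := fun h => h2 (h00.injective h)
    have h6 := Γ.ne0 (Γ.t2 a)
    simp only [horbit]
    rw [Finset.card_eq_of_equiv_fin]
    exact Fintype.equivFinOfCardEq (by
      rw [Fintype.card_coe, Finset.card_insert_of_notMem, Finset.card_insert_of_notMem,
        Finset.card_insert_of_notMem, Finset.card_singleton]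
      all_goals simp only [Finset.mem_insert, Finset.mem_singleton, not_or]
      · exact h6.symm
      · exact ⟨h3, h5.symm⟩
      · exact ⟨h1.symm, h2.symm, h4.symm⟩)
  have hinv : ∀ a b, (b = Γ.t0 a ∨ b = Γ.t2 a) → orbit a = orbit b := by
    rintro a b (rfl | rfl) <;> ext c <;>
      simp only [horbit, Finset.mem_insert, Finset.mem_singleton, ← Γ.comm02, h00 a, h22 a,
        h00 (Γ.t2 a)] <;> tauto
  have : Fintype Γ.Edge := by
    unfold Edge
    exact Fintype.ofFinite _
  have : DecidableEq Γ.Edge := Classical.decEq _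
  let mk : Φ → Γ.Edge := Quot.mk _
  have hfib : ∀ x ∈ (Finset.univ : Finset Γ.Edge),
      (Finset.univ.filter (fun a => mk a = x)).card = 4 := by
    intro x _
    obtain ⟨a, rfl⟩ := Quot.exists_rep x
    rw [← hcard a]
    congr 1
    ext b
    simp only [Finset.mem_filter, Finset.mem_univ, true_and]
    constructor
    · intro h
      have : orbit b = orbit a := congrArg (Quot.lift orbit hinv) h
      rw [← this]
      simp [horbit]
    · have e0 : ∀ c, mk (Γ.t0 c) = mk c := fun c =>
        (Quot.sound (r := fun a b => b = Γ.t0 a ∨ b = Γ.t2 a) (Or.inl rfl)).symm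
      have e2 : ∀ c, mk (Γ.t2 c) = mk c := fun c =>
        (Quot.sound (r := fun a b => b = Γ.t0 a ∨ b = Γ.t2 a) (Or.inr rfl)).symm
      intro h
      simp only [horbit, Finset.mem_insert, Finset.mem_singleton] at h
      rcases h with rfl | rfl | rfl | rfl
      · rfl
      · exact e0 a
      · exact e2 a
      · exact (e0 _).trans (e2 a)
  rw [← Finset.card_univ, Finset.card_eq_sum_card_fiberwise (f := mk) (t := Finset.univ)
    (fun _ _ => Finset.mem_univ _), Finset.sum_congr rfl hfib, Finset.sum_const, Finset.card_univ,
    numEdges, Nat.card_eq_fintype_card, smul_eq_mul, mul_comm]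

theorem finrank_face [Finite Φ] :
    Module.finrank (ZMod 2) (invariants Γ.t0 ⊓ invariants Γ.t1 : Submodule _ _) =
      Nat.card Γ.Face := by
  refine finrank_eq_card_quot _ _ fun f => ?_
  constructor
  · rintro ⟨h0, h1⟩ a b (rfl | rfl)
    exacts [(h0 a).symm, (h1 a).symm]
  · exact fun h => ⟨fun a => (h a _ (Or.inl rfl)).symm, fun a => (h a _ (Or.inr rfl)).symm⟩

theorem finrank_vertex [Finite Φ] :
    Module.finrank (ZMod 2) (invariants Γ.t1 ⊓ invariants Γ.t2 : Submodule _ _) =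
      Nat.card Γ.Vertex := by
  refine finrank_eq_card_quot _ _ fun f => ?_
  constructor
  · rintro ⟨h0, h1⟩ a b (rfl | rfl)
    exacts [(h0 a).symm, (h1 a).symm]
  · exact fun h => ⟨fun a => (h a _ (Or.inl rfl)).symm, fun a => (h a _ (Or.inr rfl)).symm⟩

theorem card_edgeOf_two [Fintype Φ] : Nat.card (Γ.toColex.EdgeOf 2) = 2 * Γ.numEdges := by
  have h : Module.finrank (ZMod 2) (invariants Γ.t2) = Nat.card (Γ.toColex.EdgeOf 2) := by
    refine finrank_eq_card_quot _ _ fun f => ?_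
    constructor
    · rintro h a b rfl
      exact (h a).symm
    · exact fun h a => (h a _ rfl).symm
  have h2 := two_mul_finrank_invariants Γ.invol2 Γ.ne2
  have := Γ.card_eq_four_mul_numEdges
  omega

theorem pullback_two_mem_invariants_zero {f : Φ → ZMod 2} (hf : f ∈ invariants Γ.t0) :
    pullback Γ.t2 f ∈ invariants Γ.t0 := fun a => by
  rw [pullback_apply, pullback_apply, ← Γ.comm02, hf]

theorem eq_of_mem_invariants {f : Φ → ZMod 2} (h0 : f ∈ invariants Γ.t0)
    (h1 : f ∈ invariants Γ.t1) (h2 : f ∈ invariants Γ.t2) (a b : Φ) : f a = f b := by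
  induction Γ.connected a b with
  | refl => rfl
  | tail _ h ih =>
    rcases h with rfl | rfl | rfl
    exacts [ih.trans (h0 _).symm, ih.trans (h1 _).symm, ih.trans (h2 _).symm]

/-- The functions on the faces such that, at every corner, the two faces across the edges of the
corner have the same value.  By connectedness the sum of the values on the two sides of an edge is
then the same for all edges, so the elements are the constants and the proper 2-colourings of the
faces, if there are any. -/
def faceColourings : Submodule (ZMod 2) (Φ → ZMod 2) :=
  (invariants Γ.t0 ⊓ invariants Γ.t1) ⊓ (invariants Γ.t1).comap (pullback Γ.t2)

/-- By connectedness, the values on the two sides of an edge have the same sum for all edges. -/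
theorem sum_sides_eq {f : Φ → ZMod 2} (hf : f ∈ Γ.faceColourings) (a b : Φ) :
    f a + f (Γ.t2 a) = f b + f (Γ.t2 b) := by
  obtain ⟨⟨h0, h1⟩, h2⟩ := hf
  refine Γ.eq_of_mem_invariants (f := f + pullback Γ.t2 f)
    (add_mem h0 (Γ.pullback_two_mem_invariants_zero h0)) (add_mem h1 h2) ?_ a b
  intro a
  simp only [Pi.add_apply, pullback_apply, Γ.invol2 a]
  exact add_comm _ _

theorem finrank_faceColourings [Finite Φ] :
    (Module.finrank (ZMod 2) Γ.faceColourings : ℤ) = 1 + Γ.dualBipartiteIndicator := by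
  obtain ⟨a⟩ := Γ.nonempty
  let ev (b : Φ) : (Φ → ZMod 2) →ₗ[ZMod 2] ZMod 2 := LinearMap.proj b
  let φ : Γ.faceColourings →ₗ[ZMod 2] ZMod 2 := (ev a + ev (Γ.t2 a)).domRestrict Γ.faceColourings
  have hφ : ∀ f : Γ.faceColourings, φ f = f.1 a + f.1 (Γ.t2 a) := fun _ => rfl
  -- The kernel consists of the constant functions.
  have hone : (fun _ => 1 : Φ → ZMod 2) ∈ Γ.faceColourings :=
    ⟨⟨fun _ => rfl, fun _ => rfl⟩, fun _ => rfl⟩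
  have hker : Module.finrank (ZMod 2) (LinearMap.ker φ) = 1 := by
    refine finrank_eq_one (⟨⟨_, hone⟩, ?_⟩ : LinearMap.ker φ) ?_ ?_
    · rw [LinearMap.mem_ker, hφ]
      exact CharTwo.add_self_eq_zero _
    · intro h
      have h' := congrFun (congrArg (fun x : LinearMap.ker φ => (x.1.1 : Φ → ZMod 2)) h) a
      exact one_ne_zero h'
    · rintro ⟨f, hf⟩
      rw [LinearMap.mem_ker, hφ] at hf
      refine ⟨f.1 a, Subtype.ext (Subtype.ext (funext fun b => ?_))⟩
      change f.1 a * 1 = f.1 b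
      rw [mul_one]
      refine Γ.eq_of_mem_invariants f.2.1.1 f.2.1.2 (fun c => ?_) a b
      have := Γ.sum_sides_eq f.2 c a
      rw [hf] at this
      exact (CharTwo.add_eq_zero.1 this).symm
  have hrk := LinearMap.finrank_range_add_finrank_ker φ
  by_cases hb : Γ.dual.IsBipartite
  · obtain ⟨κ, hκ⟩ := hb
    let f : Φ → ZMod 2 := fun b => if κ (Γ.dual.vertex b) then 1 else 0
    have v0 : ∀ b, Γ.dual.vertex (Γ.t0 b) = Γ.dual.vertex b :=
      fun b => (Quot.sound (r := fun a b => b = Γ.t1 a ∨ b = Γ.t0 a) (Or.inr rfl)).symm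
    have v1 : ∀ b, Γ.dual.vertex (Γ.t1 b) = Γ.dual.vertex b :=
      fun b => (Quot.sound (r := fun a b => b = Γ.t1 a ∨ b = Γ.t0 a) (Or.inl rfl)).symm
    have f0 : f ∈ invariants Γ.t0 := fun b => by simp only [f, v0]
    have f1 : f ∈ invariants Γ.t1 := fun b => by simp only [f, v1]
    have fs : ∀ b, f (Γ.t2 b) = f b + 1 := by
      intro b
      have := hκ b
      change κ (Γ.dual.vertex b) ≠ κ (Γ.dual.vertex (Γ.t2 b)) at this
      simp only [f]
      cases h : κ (Γ.dual.vertex b) <;> cases h' : κ (Γ.dual.vertex (Γ.t2 b)) <;>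
        simp_all
      decide
    have hf : f ∈ Γ.faceColourings := ⟨⟨f0, f1⟩, fun b => by
      rw [pullback_apply, pullback_apply, fs, fs, f1]⟩
    have hsurj : LinearMap.range φ = ⊤ := by
      refine LinearMap.range_eq_top.2 fun c => ⟨c • ⟨f, hf⟩, ?_⟩
      rw [map_smul, hφ]
      simp only [fs, ← add_assoc, CharTwo.add_self_eq_zero, zero_add, smul_eq_mul, mul_one]
    rw [hsurj, finrank_top, Module.finrank_self, hker] at hrk
    rw [dualBipartiteIndicator, if_pos ⟨κ, hκ⟩, ← hrk]
    rfl
  · have hzero : LinearMap.range φ = ⊥ := by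
      rw [LinearMap.range_eq_bot]
      ext f
      rw [hφ, LinearMap.zero_apply]
      by_contra hne
      refine hb ⟨Quot.lift (fun b => decide (f.1 b = 1)) ?_, fun b => ?_⟩
      · rintro b c (h | h)
        · change c = Γ.t1 b at h
          rw [h, f.2.1.2]
        · change c = Γ.t0 b at h
          rw [h, f.2.1.1]
      · change decide (f.1 b = 1) ≠ decide (f.1 (Γ.t2 b) = 1)
        rw [Γ.sum_sides_eq f.2 a b] at hne
        revert hne
        generalize f.1 b = x
        generalize f.1 (Γ.t2 b) = y
        revert x y
        decide
    rw [hzero, finrank_bot, hker] at hrk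
    rw [dualBipartiteIndicator, if_neg hb, ← hrk]
    rfl

end EmbeddedGraph

/-! ### The cycle space and its radical -/

namespace EmbeddedGraph

variable {Φ : Type*} (Γ : EmbeddedGraph Φ)

/-- The pairs `(s, g)` of flag functions with `s` invariant under `t0`, `s + g ∘ t2` invariant under
`t1`, and `g ∈ W`. -/
def cyclesOver (W : Submodule (ZMod 2) (Φ → ZMod 2)) :
    Submodule (ZMod 2) ((Φ → ZMod 2) × (Φ → ZMod 2)) where
  carrier := {x | x.1 ∈ invariants Γ.t0 ∧ x.1 + pullback Γ.t2 x.2 ∈ invariants Γ.t1 ∧ x.2 ∈ W}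
  add_mem' := by
    rintro x y ⟨hx1, hx2, hx3⟩ ⟨hy1, hy2, hy3⟩
    refine ⟨add_mem hx1 hy1, ?_, add_mem hx3 hy3⟩
    have := add_mem hx2 hy2
    rwa [add_add_add_comm, ← map_add] at this
  zero_mem' := ⟨zero_mem _, by simp, zero_mem _⟩
  smul_mem' := by
    rintro c x ⟨hx1, hx2, hx3⟩
    refine ⟨Submodule.smul_mem _ c hx1, ?_, Submodule.smul_mem _ c hx3⟩
    have := Submodule.smul_mem _ c hx2
    rwa [smul_add, ← map_smul] at this

theorem mem_cyclesOver {W : Submodule (ZMod 2) (Φ → ZMod 2)}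
    {x : (Φ → ZMod 2) × (Φ → ZMod 2)} :
    x ∈ Γ.cyclesOver W ↔
      x.1 ∈ invariants Γ.t0 ∧ x.1 + pullback Γ.t2 x.2 ∈ invariants Γ.t1 ∧ x.2 ∈ W := Iff.rfl

/-- The second components of cycles. -/
def cornerCycles : Submodule (ZMod 2) (Φ → ZMod 2) :=
  invariants Γ.t1 ⊓ (invariants Γ.t0 ⊔ invariants Γ.t1).comap (pullback Γ.t2)

/-- A hypercycle is encoded by the function `s` telling which `t0`-edges belong to it and the function
`g` telling which edges of the inserted faces do (an edge of an inserted face is a corner, i.e. a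
`t1`-orbit).  The evenness at the vertices of the inserted faces makes `g + g ∘ t2` the function of the
rank-3 edges, and evenness at the flags makes `s + g + g ∘ t2` the function of the `t1`-edges. -/
def cycleSpace : Submodule (ZMod 2) ((Φ → ZMod 2) × (Φ → ZMod 2)) := Γ.cyclesOver (invariants Γ.t1)

theorem cycleSpace_eq : Γ.cycleSpace = Γ.cyclesOver Γ.cornerCycles := by
  ext x
  rw [cycleSpace, mem_cyclesOver, mem_cyclesOver]
  refine ⟨fun ⟨h0, h1, h2⟩ => ⟨h0, h1, h2, ?_⟩, fun ⟨h0, h1, h2⟩ => ⟨h0, h1, h2.1⟩⟩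
  have : pullback Γ.t2 x.2 = x.1 + (x.1 + pullback Γ.t2 x.2) := by
    rw [← add_assoc, add_self_eq_zero_fun, zero_add]
  change pullback Γ.t2 x.2 ∈ invariants Γ.t0 ⊔ invariants Γ.t1
  rw [this]
  exact Submodule.add_mem_sup h0 h1

theorem finrank_cyclesOver [Finite Φ] {W : Submodule (ZMod 2) (Φ → ZMod 2)}
    (hW : W ≤ Γ.cornerCycles) :
    Module.finrank (ZMod 2) (Γ.cyclesOver W) = Nat.card Γ.Face + Module.finrank (ZMod 2) W := by
  let φ := (LinearMap.snd (ZMod 2) (Φ → ZMod 2) (Φ → ZMod 2)).domRestrict (Γ.cyclesOver W)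
  have hrange : LinearMap.range φ = W := by
    ext g
    constructor
    · rintro ⟨x, rfl⟩
      exact x.2.2.2
    · intro hg
      obtain ⟨s, hs, u, hu, hsu⟩ := Submodule.mem_sup.1 (hW hg).2
      refine ⟨⟨(s, g), hs, ?_, hg⟩, rfl⟩
      change s + pullback Γ.t2 g ∈ _
      rwa [← hsu, ← add_assoc, add_self_eq_zero_fun, zero_add]
  let ψ : (LinearMap.ker φ) →ₗ[ZMod 2] (Φ → ZMod 2) :=
    (LinearMap.fst (ZMod 2) (Φ → ZMod 2) (Φ → ZMod 2)) ∘ₗ (Γ.cyclesOver W).subtype ∘ₗ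
      (LinearMap.ker φ).subtype
  have hsnd : ∀ x : LinearMap.ker φ, x.1.1.2 = 0 := fun x => x.2
  have hinj : Function.Injective ψ := by
    intro x y hxy
    exact Subtype.ext (Subtype.ext (Prod.ext hxy ((hsnd x).trans (hsnd y).symm)))
  have hψ : LinearMap.range ψ = invariants Γ.t0 ⊓ invariants Γ.t1 := by
    ext s
    constructor
    · rintro ⟨x, rfl⟩
      refine ⟨x.1.2.1, ?_⟩
      have := x.1.2.2.1
      rw [hsnd x, map_zero, add_zero] at this
      exact this
    · rintro ⟨h0, h1⟩
      refine ⟨⟨⟨(s, 0), h0, ?_, zero_mem _⟩, rfl⟩, rfl⟩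
      change s + pullback Γ.t2 0 ∈ _
      rwa [map_zero, add_zero]
  have h1 := LinearMap.finrank_range_add_finrank_ker φ
  rw [hrange, ← LinearMap.finrank_range_of_inj hinj, hψ, finrank_face] at h1
  omega

theorem orthogonal_cornerCycles [Fintype Φ] :
    (pairing Φ).orthogonal Γ.cornerCycles =
      invariants Γ.t1 ⊔ (invariants Γ.t0 ⊓ invariants Γ.t1).comap (pullback Γ.t2) := by
  rw [cornerCycles, orthogonal_inf, orthogonal_comap_pullback Γ.invol2, orthogonal_sup,
    orthogonal_invariants Γ.invol0 Γ.ne0, orthogonal_invariants Γ.invol1 Γ.ne1]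

theorem finrank_cornerCycles [Fintype Φ] :
    Module.finrank (ZMod 2) Γ.cornerCycles + Nat.card Γ.Face =
      2 * Γ.numEdges + Module.finrank (ZMod 2) Γ.faceColourings := by
  have h1 := finrank_add_finrank_pairing_orthogonal Γ.cornerCycles
  rw [orthogonal_cornerCycles] at h1
  have h2 := Submodule.finrank_sup_add_finrank_inf_eq (invariants Γ.t1)
    ((invariants Γ.t0 ⊓ invariants Γ.t1).comap (pullback Γ.t2))
  have hz : invariants Γ.t1 ⊓ (invariants Γ.t0 ⊓ invariants Γ.t1).comap (pullback Γ.t2) =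
      Γ.faceColourings.comap (pullback Γ.t2) := by
    ext f
    simp only [faceColourings, Submodule.mem_inf, Submodule.mem_comap,
      pullback_pullback Γ.invol2]
    tauto
  rw [hz, finrank_comap_pullback Γ.invol2, finrank_comap_pullback Γ.invol2, finrank_face] at h2
  have h3 := two_mul_finrank_invariants Γ.invol1 Γ.ne1
  have h4 := Γ.card_eq_four_mul_numEdges
  omega

theorem finrank_cycleSpace [Fintype Φ] :
    Module.finrank (ZMod 2) Γ.cycleSpace =
      2 * Γ.numEdges + Module.finrank (ZMod 2) Γ.faceColourings := by
  rw [cycleSpace_eq, finrank_cyclesOver Γ le_rfl, ← finrank_cornerCycles, add_comm]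

/-- The symplectic form on the cycle space: the parity of the number of rank-3 edges common to two
hypercycles, in a form that does not mention the rank-3 edges. -/
def cycleForm [Fintype Φ] (x y : (Φ → ZMod 2) × (Φ → ZMod 2)) : ZMod 2 :=
  pairing Φ x.2 (pullback Γ.t2 y.2)

/-- The second components of the elements of the radical of the cycle space: sums of face functions
and of functions on the corners that remain such after crossing an edge. -/
def cornerRadical : Submodule (ZMod 2) (Φ → ZMod 2) :=
  (invariants Γ.t0 ⊓ invariants Γ.t1) ⊔ (invariants Γ.t1 ⊓ (invariants Γ.t1).comap (pullback Γ.t2))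

theorem cornerRadical_le : Γ.cornerRadical ≤ Γ.cornerCycles := by
  refine sup_le ?_ ?_
  · rintro f ⟨h0, h1⟩
    exact ⟨h1, Submodule.mem_sup_left (Γ.pullback_two_mem_invariants_zero h0)⟩
  · rintro f ⟨h1, h2⟩
    exact ⟨h1, Submodule.mem_sup_right h2⟩

theorem cornerCycles_inf_comap_orthogonal [Fintype Φ] :
    Γ.cornerCycles ⊓ ((pairing Φ).orthogonal Γ.cornerCycles).comap (pullback Γ.t2) =
      Γ.cornerRadical := by
  rw [orthogonal_cornerCycles]
  apply le_antisymm
  · rintro g ⟨⟨hg1, -⟩, hg⟩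
    obtain ⟨u, hu, w, hw, huw⟩ := Submodule.mem_sup.1 hg
    have hgw : g = pullback Γ.t2 w + pullback Γ.t2 u := by
      rw [← map_add, add_comm w, huw, pullback_pullback Γ.invol2]
    have hgu : pullback Γ.t2 u = g + pullback Γ.t2 w := by
      rw [hgw, add_right_comm, add_self_eq_zero_fun, zero_add]
    rw [hgw]
    refine Submodule.add_mem_sup hw ⟨?_, ?_⟩
    · rw [hgu]
      exact add_mem hg1 hw.2
    · change pullback Γ.t2 (pullback Γ.t2 u) ∈ invariants Γ.t1
      rwa [pullback_pullback Γ.invol2]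
  · refine le_inf Γ.cornerRadical_le (sup_le ?_ ?_)
    · intro f hf
      refine Submodule.mem_sup_right ?_
      rw [Submodule.mem_comap, pullback_pullback Γ.invol2]
      exact hf
    · rintro f ⟨-, h2⟩
      exact Submodule.mem_sup_left h2

/-- The radical of `cycleForm` on the cycle space. -/
theorem mem_cyclesOver_cornerRadical_iff [Fintype Φ] (x : (Φ → ZMod 2) × (Φ → ZMod 2)) :
    x ∈ Γ.cyclesOver Γ.cornerRadical ↔
      x ∈ Γ.cycleSpace ∧ ∀ y ∈ Γ.cycleSpace, Γ.cycleForm y x = 0 := by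
  rw [← cornerCycles_inf_comap_orthogonal, cycleSpace_eq]
  constructor
  · rintro ⟨h0, h1, h2, h3⟩
    exact ⟨⟨h0, h1, h2⟩, fun y hy => h3 _ hy.2.2⟩
  · rintro ⟨⟨h0, h1, h2⟩, h⟩
    refine ⟨h0, h1, h2, fun g hg => ?_⟩
    obtain ⟨s, hs, u, hu, hsu⟩ := Submodule.mem_sup.1 hg.2
    refine h (s, g) ⟨hs, ?_, hg⟩
    change s + pullback Γ.t2 g ∈ _
    rwa [← hsu, ← add_assoc, add_self_eq_zero_fun, zero_add]

/-- With a 2-colouring `q` of the corners that alternates around every vertex, each corner function whose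
pullback by `t2` is a corner function is a unique combination `γ + q * γ'` of vertex functions. -/
theorem finrank_crossing_corners [Finite Φ] {q : Φ → ZMod 2} (hq1 : q ∈ invariants Γ.t1)
    (hq2 : ∀ a, q (Γ.t2 a) = q a + 1) :
    Module.finrank (ZMod 2)
      (invariants Γ.t1 ⊓ (invariants Γ.t1).comap (pullback Γ.t2) : Submodule _ _) =
      2 * Nat.card Γ.Vertex := by
  let U := invariants Γ.t1 ⊓ (invariants Γ.t1).comap (pullback Γ.t2)
  let φ := (LinearMap.id + pullback Γ.t2).domRestrict U
  have hφ : ∀ f : U, φ f = f.1 + pullback Γ.t2 f.1 := fun _ => rfl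
  have hrange : LinearMap.range φ = invariants Γ.t1 ⊓ invariants Γ.t2 := by
    ext f
    constructor
    · rintro ⟨x, rfl⟩
      rw [hφ]
      refine ⟨add_mem x.2.1 x.2.2, fun a => ?_⟩
      simp only [Pi.add_apply, pullback_apply, Γ.invol2 a]
      exact add_comm _ _
    · rintro ⟨h1, h2⟩
      refine ⟨⟨q * f, mul_mem_invariants hq1 h1, fun a => ?_⟩, ?_⟩
      · simp only [pullback_apply, Pi.mul_apply, h2 _, hq2, hq1 a, h1 a]
      · rw [hφ]
        ext a
        simp only [Pi.add_apply, Pi.mul_apply, pullback_apply, h2 _, hq2, add_mul, one_mul,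
          ← add_assoc, CharTwo.add_self_eq_zero, zero_add]
  have hker : (LinearMap.ker φ).map U.subtype = invariants Γ.t1 ⊓ invariants Γ.t2 := by
    ext f
    simp only [Submodule.mem_map, LinearMap.mem_ker, hφ]
    constructor
    · rintro ⟨x, hx, rfl⟩
      refine ⟨x.2.1, fun a => ?_⟩
      exact (CharTwo.add_eq_zero.1 (congrFun hx a)).symm
    · rintro ⟨h1, h2⟩
      refine ⟨⟨f, h1, fun a => ?_⟩, ?_, rfl⟩
      · simp only [pullback_apply, h2 _, h1 a]
      · ext a
        simp only [Pi.add_apply, pullback_apply, h2 a, CharTwo.add_self_eq_zero, Pi.zero_apply]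
  have h1 := LinearMap.finrank_range_add_finrank_ker φ
  rw [hrange, ← Submodule.finrank_map_subtype_eq U (LinearMap.ker φ), hker, finrank_vertex] at h1
  change Module.finrank (ZMod 2) U = _
  omega

/-- The dimension of the radical of the cycle space. -/
theorem finrank_cyclesOver_cornerRadical [Finite Φ] {q : Φ → ZMod 2} (hq1 : q ∈ invariants Γ.t1)
    (hq2 : ∀ a, q (Γ.t2 a) = q a + 1) :
    Module.finrank (ZMod 2) (Γ.cyclesOver Γ.cornerRadical) +
        Module.finrank (ZMod 2) Γ.faceColourings =
      2 * Nat.card Γ.Face + 2 * Nat.card Γ.Vertex := by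
  rw [finrank_cyclesOver Γ Γ.cornerRadical_le]
  have h := Submodule.finrank_sup_add_finrank_inf_eq (invariants Γ.t0 ⊓ invariants Γ.t1)
    (invariants Γ.t1 ⊓ (invariants Γ.t1).comap (pullback Γ.t2))
  have hz : (invariants Γ.t0 ⊓ invariants Γ.t1) ⊓
      (invariants Γ.t1 ⊓ (invariants Γ.t1).comap (pullback Γ.t2)) = Γ.faceColourings := by
    ext f
    simp only [faceColourings, Submodule.mem_inf]
    tauto
  rw [hz, finrank_face, finrank_crossing_corners Γ hq1 hq2] at h
  rw [cornerRadical]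
  omega

end EmbeddedGraph

/-! ### Pauli operators as vectors of a symplectic space over `𝔽₂` -/

namespace PauliLetter

/-- `1` if two Pauli matrices anticommute and `0` if they commute. -/
def comm : PauliLetter → PauliLetter → ZMod 2
  | X, Y => 1
  | X, Z => 1
  | Y, X => 1
  | Y, Z => 1
  | Z, X => 1
  | Z, Y => 1
  | _, _ => 0

/-- A Pauli matrix is `X ^ x * Z ^ z` up to a phase; the first coordinate is `x` and the second is
`z`. -/
def vec : PauliLetter → ZMod 2 × ZMod 2
  | I => (0, 0)
  | X => (1, 0)
  | Y => (1, 1)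
  | Z => (0, 1)

theorem vec_mul : ∀ p q, vec (mul p q) = vec p + vec q := by decide

theorem vec_injective : Function.Injective vec := by
  intro p q
  revert p q
  decide

theorem vec_surjective : Function.Surjective vec := by
  intro x
  revert x
  decide

theorem comm_eq : ∀ p q, comm p q = (vec p).1 * (vec q).2 + (vec p).2 * (vec q).1 := by decide

theorem comm_eq_ite : ∀ p q, p ≠ I → q ≠ I → comm p q = if p = q then 0 else 1 := by decide

/-- The embedding of `ZMod 2` in `ZMod 4`. -/
def double : ZMod 2 →+ ZMod 4 where
  toFun x := if x = 0 then 0 else 2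
  map_zero' := rfl
  map_add' := by decide

theorem double_eq_zero : ∀ x, double x = 0 ↔ x = 0 := by decide

theorem phase_comm : ∀ p q, phase p q = phase q p + double (comm p q) := by decide

theorem mul_comm' : ∀ p q, mul p q = mul q p := by decide

end PauliLetter

/-- The symplectic form on vectors of Pauli operators. -/
def symplecticForm (V : Type*) [Fintype V] : LinearMap.BilinForm (ZMod 2) (V → ZMod 2 × ZMod 2) :=
  LinearMap.mk₂ (ZMod 2) (fun x y => ∑ v, ((x v).1 * (y v).2 + (x v).2 * (y v).1))
    (fun x x' y => by
      rw [← Finset.sum_add_distrib]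
      refine Finset.sum_congr rfl fun v _ => ?_
      simp only [Pi.add_apply, Prod.fst_add, Prod.snd_add]
      ring)
    (fun c x y => by
      rw [smul_eq_mul, Finset.mul_sum]
      refine Finset.sum_congr rfl fun v _ => ?_
      simp only [Pi.smul_apply, Prod.smul_fst, Prod.smul_snd, smul_eq_mul]
      ring)
    (fun x y y' => by
      rw [← Finset.sum_add_distrib]
      refine Finset.sum_congr rfl fun v _ => ?_
      simp only [Pi.add_apply, Prod.fst_add, Prod.snd_add]
      ring)
    (fun c x y => by
      rw [smul_eq_mul, Finset.mul_sum]
      refine Finset.sum_congr rfl fun v _ => ?_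
      simp only [Pi.smul_apply, Prod.smul_fst, Prod.smul_snd, smul_eq_mul]
      ring)

section SymplecticForm

variable {V : Type*} [Fintype V]

theorem symplecticForm_apply (x y : V → ZMod 2 × ZMod 2) :
    symplecticForm V x y = ∑ v, ((x v).1 * (y v).2 + (x v).2 * (y v).1) := rfl

theorem symplecticForm_comm (x y : V → ZMod 2 × ZMod 2) :
    symplecticForm V x y = symplecticForm V y x := by
  rw [symplecticForm_apply, symplecticForm_apply]
  exact Finset.sum_congr rfl fun v _ => by ring

theorem symplecticForm_isRefl : (symplecticForm V).IsRefl := fun x y h => by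
  rwa [symplecticForm_comm]

theorem symplecticForm_nondegenerate : (symplecticForm V).Nondegenerate := by
  classical
  have h : ∀ x : V → ZMod 2 × ZMod 2, (∀ y, symplecticForm V x y = 0) → x = 0 := by
    intro x hx
    ext v
    · simpa [symplecticForm_apply, Pi.single_apply, apply_ite Prod.fst, apply_ite Prod.snd]
        using hx (Pi.single v (0, 1))
    · simpa [symplecticForm_apply, Pi.single_apply, apply_ite Prod.fst, apply_ite Prod.snd]
        using hx (Pi.single v (1, 0))
  exact ⟨h, fun y hy => h y fun x => by rw [symplecticForm_comm]; exact hy x⟩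

theorem finrank_add_finrank_symplectic_orthogonal (W : Submodule (ZMod 2) (V → ZMod 2 × ZMod 2)) :
    Module.finrank (ZMod 2) W + Module.finrank (ZMod 2) ((symplecticForm V).orthogonal W) =
      2 * Fintype.card V := by
  have h := LinearMap.BilinForm.finrank_orthogonal (B := symplecticForm V)
    symplecticForm_nondegenerate W
  have hle := Submodule.finrank_le W
  have hV : Module.finrank (ZMod 2) (V → ZMod 2 × ZMod 2) = 2 * Fintype.card V := by
    rw [Module.finrank_pi_fintype]
    simp [mul_comm]
  omega

end SymplecticForm

namespace Pauli

/-- The vector of a Pauli operator, which determines it up to a phase. -/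
def vec {V : Type*} (p : Pauli V) : V → ZMod 2 × ZMod 2 := fun v => (p.word v).vec

variable {V : Type*}

theorem word_eq_of_vec_eq {p q : Pauli V} (h : vec p = vec q) : p.word = q.word :=
  funext fun v => PauliLetter.vec_injective (congrFun h v)

theorem exists_vec_eq (x : V → ZMod 2 × ZMod 2) : ∃ p : Pauli V, vec p = x := by
  choose w hw using fun v => PauliLetter.vec_surjective (x v)
  exact ⟨⟨0, w⟩, funext hw⟩

variable [Fintype V]

theorem vec_mul (p q : Pauli V) : vec (p * q) = vec p + vec q :=
  funext fun _ => PauliLetter.vec_mul _ _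

theorem vec_one : vec (1 : Pauli V) = 0 := rfl

theorem vec_list_prod (l : List (Pauli V)) : vec l.prod = (l.map vec).sum := by
  induction l with
  | nil => rfl
  | cons p l ih => rw [List.prod_cons, vec_mul, ih, List.map_cons, List.sum_cons]

theorem commute_iff (p q : Pauli V) : p * q = q * p ↔ symplecticForm V (vec p) (vec q) = 0 := by
  have hs : symplecticForm V (vec p) (vec q) =
      ∑ v, PauliLetter.comm (p.word v) (q.word v) :=
    Finset.sum_congr rfl fun v _ => (PauliLetter.comm_eq _ _).symm
  have hp : (p * q).phase = (q * p).phase + PauliLetter.double (symplecticForm V (vec p) (vec q)) := by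
    change p.phase + q.phase + ∑ v, PauliLetter.phase (p.word v) (q.word v) =
      q.phase + p.phase + (∑ v, PauliLetter.phase (q.word v) (p.word v)) + _
    rw [hs, map_sum, add_assoc (q.phase + p.phase), ← Finset.sum_add_distrib, add_comm q.phase,
      Finset.sum_congr rfl fun v _ => PauliLetter.phase_comm (p.word v) (q.word v)]
  constructor
  · intro h
    rw [h] at hp
    exact (PauliLetter.double_eq_zero _).1 (left_eq_add.1 hp)
  · intro h
    rw [h, map_zero, add_zero] at hp
    exact Pauli.ext hp (funext fun v => PauliLetter.mul_comm' _ _)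

theorem mem_of_vec_eq {G : Subgroup (Pauli V)} (hG : scalarI ∈ G) {p q : Pauli V} (hq : q ∈ G)
    (h : vec p = vec q) : p ∈ G := by
  have hpow : ∀ n : ℕ, (scalarI : Pauli V) ^ n = ⟨n, fun _ => PauliLetter.I⟩ := by
    intro n
    induction n with
    | zero => simp; rfl
    | succ n ih =>
      rw [pow_succ, ih]
      refine Pauli.ext ?_ rfl
      change (n : ZMod 4) + 1 + ∑ _v : V, 0 = _
      simp
  have hp : p = scalarI ^ (p.phase - q.phase).val * q := by
    rw [hpow]
    refine Pauli.ext ?_ ?_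
    · change _ = ((p.phase - q.phase).val : ZMod 4) + q.phase +
        ∑ v, PauliLetter.phase PauliLetter.I (q.word v)
      simp [PauliLetter.phase_I_left]
    · rw [word_eq_of_vec_eq h]
      exact funext fun v => (PauliLetter.I_mul _).symm
  rw [hp]
  exact mul_mem (pow_mem hG _) hq

end Pauli

namespace SubsystemCode

variable {V : Type*} [Fintype V]

/-- The vectors of the elements of a subgroup. -/
def space (G : Subgroup (Pauli V)) : Submodule (ZMod 2) (V → ZMod 2 × ZMod 2) :=
  AddSubgroup.toZModSubmodule 2
    { carrier := Pauli.vec '' (G : Set (Pauli V))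
      add_mem' := by
        rintro _ _ ⟨p, hp, rfl⟩ ⟨q, hq, rfl⟩
        exact ⟨p * q, mul_mem hp hq, Pauli.vec_mul p q⟩
      zero_mem' := ⟨1, one_mem _, Pauli.vec_one⟩
      neg_mem' := by
        rintro _ ⟨p, hp, rfl⟩
        exact ⟨p, hp, funext fun v => by simp [Prod.ext_iff]⟩ }

theorem vec_mem_space_iff {G : Subgroup (Pauli V)} (hG : Pauli.scalarI ∈ G) {p : Pauli V} :
    p.vec ∈ space G ↔ p ∈ G :=
  ⟨fun ⟨_, hq, h⟩ => Pauli.mem_of_vec_eq hG hq h.symm, fun h => ⟨p, h, rfl⟩⟩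

theorem hasDim_finrank (G : Subgroup (Pauli V)) : HasDim G (Module.finrank (ZMod 2) (space G)) := by
  have h : Pauli.vec '' (G : Set (Pauli V)) =
      (fun w v => PauliLetter.vec (w v)) '' (Pauli.word '' (G : Set (Pauli V))) := by
    rw [Set.image_image]
    rfl
  have hinj : Function.Injective
      (fun (w : V → PauliLetter) v => PauliLetter.vec (w v)) := fun w w' h =>
    funext fun v => PauliLetter.vec_injective (congrFun h v)
  have hc : (Pauli.word '' (G : Set (Pauli V))).ncard = Nat.card (space G) := by
    rw [← Set.ncard_image_of_injective _ hinj, ← h]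
    rfl
  rw [HasDim, hc, Module.natCard_eq_pow_finrank (K := ZMod 2), Nat.card_zmod]

theorem mem_centralizer_iff {G : Subgroup (Pauli V)} {p : Pauli V} :
    p ∈ centralizer G ↔ ∀ q ∈ G, symplecticForm V q.vec p.vec = 0 := by
  rw [centralizer, Subgroup.mem_centralizer_iff]
  exact forall₂_congr fun q _ => Pauli.commute_iff q p

theorem space_centralizer (G : Subgroup (Pauli V)) :
    space (centralizer G) = (symplecticForm V).orthogonal (space G) := by
  ext x
  constructor
  · rintro ⟨p, hp, rfl⟩ _ ⟨q, hq, rfl⟩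
    exact mem_centralizer_iff.1 hp q hq
  · intro hx
    obtain ⟨p, rfl⟩ := Pauli.exists_vec_eq x
    exact ⟨p, mem_centralizer_iff.2 fun q hq => hx _ ⟨q, hq, rfl⟩, rfl⟩

theorem space_stabilizer {G : Subgroup (Pauli V)} (hG : Pauli.scalarI ∈ G) :
    space (stabilizer G) = space G ⊓ space (centralizer G) := by
  ext x
  constructor
  · rintro ⟨p, hp, rfl⟩
    exact ⟨⟨p, hp.1, rfl⟩, ⟨p, hp.2, rfl⟩⟩
  · rintro ⟨hx, ⟨p, hp, rfl⟩⟩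
    exact ⟨p, ⟨(vec_mem_space_iff hG).1 hx, hp⟩, rfl⟩

theorem space_eq_orthogonal (G : Subgroup (Pauli V)) :
    space G = (symplecticForm V).orthogonal (space (centralizer G)) := by
  rw [space_centralizer, LinearMap.BilinForm.orthogonal_orthogonal symplecticForm_nondegenerate
    symplecticForm_isRefl]

theorem mem_space_iff (G : Subgroup (Pauli V)) (x : V → ZMod 2 × ZMod 2) :
    x ∈ space G ↔ ∀ y ∈ space (centralizer G), symplecticForm V y x = 0 := by
  rw [space_eq_orthogonal, LinearMap.BilinForm.mem_orthogonal_iff]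

/-- The parameters of a subsystem code from the dimensions of the centralizer of the gauge group and of
the stabilizer. -/
theorem hasParameters_of_finrank {G : Subgroup (Pauli V)} (hG : Pauli.scalarI ∈ G) {n k r s : ℕ}
    (hn : n = Fintype.card V) (hsum : n = k + r + s)
    (hC : Module.finrank (ZMod 2) (space (centralizer G)) = 2 * k + s)
    (hS : Module.finrank (ZMod 2) (space (stabilizer G)) = s) : HasParameters G n k r := by
  have h := finrank_add_finrank_symplectic_orthogonal (space G)
  rw [← space_centralizer, hC] at h
  have h' : Module.finrank (ZMod 2) (space G) = 2 * r + s := by omega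
  refine ⟨hG, hn, s, hsum, ?_, ?_, ?_⟩
  · rw [← hS]
    exact hasDim_finrank _
  · rw [← h']
    exact hasDim_finrank _
  · rw [← hC]
    exact hasDim_finrank _

end SubsystemCode

/-! ### Edges and colourings of the hypergraph -/

theorem ncard_pair_le {α : Type*} (a b : α) : ({a, b} : Set α).ncard ≤ 2 := by
  have h := Set.ncard_insert_le a {b}
  rwa [Set.ncard_singleton] at h

namespace EmbeddedGraph

variable {Φ : Type*} (Γ : EmbeddedGraph Φ)

/-- The vertex of the inserted face at the rank-3 edge of the flag `a`. -/
def tip (a : Φ) : Φ ⊕ Γ.toColex.EdgeOf 2 := Sum.inr (Γ.toColex.edgeOf 2 a)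

/-- The rank-2 edge of `t0` at a flag. -/
def link0 (a : Φ) : Set (Φ ⊕ Γ.toColex.EdgeOf 2) := {Sum.inl a, Sum.inl (Γ.t0 a)}

/-- The rank-2 edge of `t1` at a flag. -/
def link1 (a : Φ) : Set (Φ ⊕ Γ.toColex.EdgeOf 2) := {Sum.inl a, Sum.inl (Γ.t1 a)}

/-- The rank-3 edge at a flag. -/
def triangle (a : Φ) : Set (Φ ⊕ Γ.toColex.EdgeOf 2) := {Sum.inl a, Sum.inl (Γ.t2 a), Γ.tip a}

/-- The edge of an inserted face at the corner of a flag. -/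
def innerLink (a : Φ) : Set (Φ ⊕ Γ.toColex.EdgeOf 2) := {Γ.tip a, Γ.tip (Γ.t1 a)}

theorem mem_edgeSet_iff (e : Set (Φ ⊕ Γ.toColex.EdgeOf 2)) :
    e ∈ Γ.subsystemHypergraph.edgeSet ↔
      (∃ a, e = Γ.link0 a) ∨ (∃ a, e = Γ.link1 a) ∨ (∃ a, e = Γ.triangle a) ∨
        ∃ a, e = Γ.innerLink a := by
  constructor
  · rintro ((⟨i, a, hi, rfl⟩ | ⟨a, rfl⟩) | ⟨i, a, hi, hi', rfl⟩)
    · fin_cases i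
      · exact Or.inl ⟨a, rfl⟩
      · exact Or.inr (Or.inl ⟨a, rfl⟩)
      · exact absurd rfl hi
    · exact Or.inr (Or.inr (Or.inl ⟨a, rfl⟩))
    · fin_cases i
      · exact absurd rfl hi'
      · exact Or.inr (Or.inr (Or.inr ⟨a, rfl⟩))
      · exact absurd rfl hi
  · rintro (⟨a, rfl⟩ | ⟨a, rfl⟩ | ⟨a, rfl⟩ | ⟨a, rfl⟩)
    · exact Or.inl (Or.inl ⟨0, a, by decide, rfl⟩)
    · exact Or.inl (Or.inl ⟨1, a, by decide, rfl⟩)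
    · exact Or.inl (Or.inr ⟨a, rfl⟩)
    · exact Or.inr ⟨1, a, by decide, by decide, rfl⟩

theorem link0_mem (a : Φ) : Γ.link0 a ∈ Γ.subsystemHypergraph.edgeSet :=
  (Γ.mem_edgeSet_iff _).2 (Or.inl ⟨a, rfl⟩)

theorem link1_mem (a : Φ) : Γ.link1 a ∈ Γ.subsystemHypergraph.edgeSet :=
  (Γ.mem_edgeSet_iff _).2 (Or.inr (Or.inl ⟨a, rfl⟩))

theorem triangle_mem (a : Φ) : Γ.triangle a ∈ Γ.subsystemHypergraph.edgeSet :=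
  (Γ.mem_edgeSet_iff _).2 (Or.inr (Or.inr (Or.inl ⟨a, rfl⟩)))

theorem innerLink_mem (a : Φ) : Γ.innerLink a ∈ Γ.subsystemHypergraph.edgeSet :=
  (Γ.mem_edgeSet_iff _).2 (Or.inr (Or.inr (Or.inr ⟨a, rfl⟩)))

theorem tip_t2 (a : Φ) : Γ.tip (Γ.t2 a) = Γ.tip a :=
  congrArg Sum.inr (Quot.sound (r := fun a b : Φ => b = Γ.t2 a) rfl).symm

theorem tip_eq_iff (a b : Φ) : Γ.tip a = Γ.tip b ↔ a = b ∨ a = Γ.t2 b := by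
  constructor
  · intro h
    have hl : ∀ c d, d = Γ.t2 c → ({c, Γ.t2 c} : Set Φ) = {d, Γ.t2 d} := by
      rintro c _ rfl
      rw [Γ.invol2, Set.pair_comm]
    have := congrArg (Quot.lift (fun c => ({c, Γ.t2 c} : Set Φ)) hl) (Sum.inr_injective h)
    change ({a, Γ.t2 a} : Set Φ) = {b, Γ.t2 b} at this
    have ha : a ∈ ({b, Γ.t2 b} : Set Φ) := this ▸ Set.mem_insert _ _
    exact ha
  · rintro (rfl | rfl)
    exacts [rfl, Γ.tip_t2 b]

theorem link0_t0 (a : Φ) : Γ.link0 (Γ.t0 a) = Γ.link0 a := by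
  rw [link0, link0, Γ.invol0, Set.pair_comm]

theorem link1_t1 (a : Φ) : Γ.link1 (Γ.t1 a) = Γ.link1 a := by
  rw [link1, link1, Γ.invol1, Set.pair_comm]

theorem triangle_t2 (a : Φ) : Γ.triangle (Γ.t2 a) = Γ.triangle a := by
  rw [triangle, triangle, Γ.invol2, tip_t2, Set.insert_comm]

theorem innerLink_t1 (a : Φ) : Γ.innerLink (Γ.t1 a) = Γ.innerLink a := by
  rw [innerLink, innerLink, Γ.invol1, Set.pair_comm]

theorem eq_of_inl_mem {e : Set (Φ ⊕ Γ.toColex.EdgeOf 2)} (he : e ∈ Γ.subsystemHypergraph.edgeSet)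
    {a : Φ} (ha : Sum.inl a ∈ e) : e = Γ.link0 a ∨ e = Γ.link1 a ∨ e = Γ.triangle a := by
  rcases (Γ.mem_edgeSet_iff e).1 he with ⟨b, rfl⟩ | ⟨b, rfl⟩ | ⟨b, rfl⟩ | ⟨b, rfl⟩
  · rcases ha with h | h <;> cases h
    exacts [Or.inl rfl, Or.inl (Γ.link0_t0 b).symm]
  · rcases ha with h | h <;> cases h
    exacts [Or.inr (Or.inl rfl), Or.inr (Or.inl (Γ.link1_t1 b).symm)]
  · rcases ha with h | h | h <;> cases h
    exacts [Or.inr (Or.inr rfl), Or.inr (Or.inr (Γ.triangle_t2 b).symm)]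
  · rcases ha with h | h <;> cases h

theorem eq_of_tip_mem {e : Set (Φ ⊕ Γ.toColex.EdgeOf 2)} (he : e ∈ Γ.subsystemHypergraph.edgeSet)
    {a : Φ} (ha : Γ.tip a ∈ e) :
    e = Γ.innerLink a ∨ e = Γ.innerLink (Γ.t2 a) ∨ e = Γ.triangle a := by
  rcases (Γ.mem_edgeSet_iff e).1 he with ⟨b, rfl⟩ | ⟨b, rfl⟩ | ⟨b, rfl⟩ | ⟨b, rfl⟩
  · rcases ha with h | h <;> cases h
  · rcases ha with h | h <;> cases h
  · rcases ha with h | h | h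
    · cases h
    · cases h
    · rcases (Γ.tip_eq_iff _ _).1 h with rfl | rfl
      exacts [Or.inr (Or.inr rfl), Or.inr (Or.inr (Γ.triangle_t2 b).symm)]
  · have aux : ∀ c, Γ.tip a = Γ.tip c →
        Γ.innerLink c = Γ.innerLink a ∨ Γ.innerLink c = Γ.innerLink (Γ.t2 a) := by
      intro c h
      rcases (Γ.tip_eq_iff _ _).1 h with rfl | rfl
      exacts [Or.inl rfl, Or.inr (by rw [Γ.invol2])]
    rcases ha with h | h
    · rcases aux b h with h' | h'
      exacts [Or.inl h', Or.inr (Or.inl h')]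
    · rcases aux _ h with h' | h' <;> rw [innerLink_t1] at h'
      exacts [Or.inl h', Or.inr (Or.inl h')]

theorem inl_mem_triangle (a : Φ) : Sum.inl a ∈ Γ.triangle a := Set.mem_insert _ _

theorem tip_mem_triangle (a : Φ) : Γ.tip a ∈ Γ.triangle a := Or.inr (Or.inr rfl)

theorem tip_mem_innerLink (a : Φ) : Γ.tip a ∈ Γ.innerLink a := Set.mem_insert _ _

theorem inl_mem_link0 (a : Φ) : Sum.inl a ∈ Γ.link0 a := Set.mem_insert _ _

theorem inl_mem_link1 (a : Φ) : Sum.inl a ∈ Γ.link1 a := Set.mem_insert _ _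

theorem triangle_ne_link0 (a b : Φ) : Γ.triangle a ≠ Γ.link0 b := fun h => by
  have := h ▸ Γ.tip_mem_triangle a
  rcases this with h | h <;> cases h

theorem triangle_ne_link1 (a b : Φ) : Γ.triangle a ≠ Γ.link1 b := fun h => by
  have := h ▸ Γ.tip_mem_triangle a
  rcases this with h | h <;> cases h

theorem triangle_ne_innerLink (a b : Φ) : Γ.triangle a ≠ Γ.innerLink b := fun h => by
  have := h ▸ Γ.inl_mem_triangle a
  rcases this with h | h <;> cases h

theorem innerLink_ne_link0 (a b : Φ) : Γ.innerLink a ≠ Γ.link0 b := fun h => by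
  have := h ▸ Γ.tip_mem_innerLink a
  rcases this with h | h <;> cases h

theorem innerLink_ne_link1 (a b : Φ) : Γ.innerLink a ≠ Γ.link1 b := fun h => by
  have := h ▸ Γ.tip_mem_innerLink a
  rcases this with h | h <;> cases h

theorem link0_ne_link1 (hloop : Γ.Loopless) (a b : Φ) : Γ.link0 a ≠ Γ.link1 b := by
  -- Equality would make `t0` and `t1` agree at `a`, so that the edge at `a` would be a loop.
  have key : ∀ c, Γ.link0 c ≠ Γ.link1 c := fun c h => by
    have hm : Sum.inl (Γ.t0 c) ∈ Γ.link1 c := h ▸ Or.inr rfl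
    rcases hm with h | h
    · exact Γ.ne0 c (Sum.inl_injective h)
    · refine hloop c ?_
      rw [Sum.inl_injective h]
      exact Quot.sound (Or.inl rfl)
  intro h
  have ha : Sum.inl a ∈ Γ.link1 b := h ▸ Γ.inl_mem_link0 a
  rcases ha with h' | h'
  · rw [Sum.inl_injective h'] at h
    exact key b h
  · rw [← Γ.link1_t1 b, ← Sum.inl_injective h'] at h
    exact key a h

/-- Two flags at the same vertex are joined by a sequence of `t1`- and `t2`-moves. -/
theorem vertex_induction {P : Φ → Prop} (h1 : ∀ a, P a → P (Γ.t1 a)) (h2 : ∀ a, P a → P (Γ.t2 a))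
    {a b : Φ} (hab : Γ.vertex a = Γ.vertex b) (ha : P a) : P b := by
  have hl : ∀ c d, (d = Γ.t1 c ∨ d = Γ.t2 c) → P c = P d := by
    rintro c d (rfl | rfl)
    · exact propext ⟨h1 c, fun h => by simpa [Γ.invol1 c] using h1 _ h⟩
    · exact propext ⟨h2 c, fun h => by simpa [Γ.invol2 c] using h2 _ h⟩
  have h : P a = P b := congrArg (Quot.lift P hl) hab
  rwa [← h]

/-- The rotation at a vertex of degree greater than two does not have order two. -/
theorem t1_t2_ne (hdeg : ∀ v : Γ.Vertex, 2 < Γ.degree v) (a : Φ) :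
    Γ.t1 (Γ.t2 a) ≠ Γ.t2 (Γ.t1 a) := by
  intro h
  have hsub : Γ.edgeEnd '' {φ | Γ.vertex φ = Γ.vertex a} ⊆
      {Γ.edgeEnd a, Γ.edgeEnd (Γ.t1 a)} := by
    rintro _ ⟨b, hb, rfl⟩
    have he : ∀ c, Γ.edgeEnd (Γ.t2 c) = Γ.edgeEnd c :=
      fun c => (Quot.sound (r := fun a b : Φ => b = Γ.t2 a) rfl).symm
    have hb' : b ∈ ({a, Γ.t1 a, Γ.t2 a, Γ.t2 (Γ.t1 a)} : Set Φ) := by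
      refine Γ.vertex_induction (P := fun c => c ∈ ({a, Γ.t1 a, Γ.t2 a, Γ.t2 (Γ.t1 a)} : Set Φ))
        ?_ ?_ (Eq.symm hb) (Or.inl rfl)
      · rintro c (rfl | rfl | rfl | rfl)
        · simp
        · simp [Γ.invol1 a]
        · simp [h]
        · simp [← h, Γ.invol1 (Γ.t2 a)]
      · rintro c (rfl | rfl | rfl | rfl)
        · simp
        · simp
        · simp [Γ.invol2 a]
        · simp [Γ.invol2 (Γ.t1 a)]
    rcases hb' with rfl | rfl | rfl | rfl
    · exact Or.inl rfl
    · exact Or.inr rfl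
    · exact Or.inl (he a)
    · exact Or.inr (he _)
  have hle := Set.ncard_le_ncard hsub (Set.toFinite _)
  have h2 := ncard_pair_le (Γ.edgeEnd a) (Γ.edgeEnd (Γ.t1 a))
  have h3 := hdeg (Γ.vertex a)
  unfold degree at h3
  omega

theorem tip_t1_ne (hdeg : ∀ v : Γ.Vertex, 2 < Γ.degree v) (a : Φ) : Γ.tip (Γ.t1 a) ≠ Γ.tip a := by
  intro h
  rcases (Γ.tip_eq_iff _ _).1 h with h | h
  · exact Γ.ne1 a h
  · exact Γ.t1_t2_ne hdeg a (by rw [h, Γ.invol2, ← h, Γ.invol1])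

theorem innerLink_t2_ne (hdeg : ∀ v : Γ.Vertex, 2 < Γ.degree v) (a : Φ) :
    Γ.innerLink a ≠ Γ.innerLink (Γ.t2 a) := by
  have h12 := Γ.t1_t2_ne hdeg a
  intro h
  have hm : Γ.tip (Γ.t1 a) ∈ Γ.innerLink (Γ.t2 a) := h ▸ Or.inr rfl
  rcases hm with h' | h'
  · rw [tip_t2] at h'
    exact Γ.tip_t1_ne hdeg a h'
  · rcases (Γ.tip_eq_iff _ _).1 (Eq.symm h') with h' | h'
    · exact Γ.ne2 a (Γ.invol1.injective h')
    · exact h12 h'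

theorem ncard_triangle (a : Φ) : (Γ.triangle a).ncard = 3 := by
  rw [triangle, Set.ncard_insert_of_notMem, Set.ncard_pair]
  · exact fun h => nomatch h
  · rintro (h | h)
    · exact Γ.ne2 a (Sum.inl_injective h).symm
    · cases h

theorem exists_triangle_of_ncard {e : Set (Φ ⊕ Γ.toColex.EdgeOf 2)}
    (he : e ∈ Γ.subsystemHypergraph.edgeSet) (h3 : e.ncard = 3) : ∃ a, e = Γ.triangle a := by
  rcases (Γ.mem_edgeSet_iff e).1 he with ⟨a, rfl⟩ | ⟨a, rfl⟩ | h | ⟨a, rfl⟩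
  · have := ncard_pair_le (Sum.inl a : Φ ⊕ Γ.toColex.EdgeOf 2) (Sum.inl (Γ.t0 a))
    rw [link0] at h3
    omega
  · have := ncard_pair_le (Sum.inl a : Φ ⊕ Γ.toColex.EdgeOf 2) (Sum.inl (Γ.t1 a))
    rw [link1] at h3
    omega
  · exact h
  · have := ncard_pair_le (Γ.tip a) (Γ.tip (Γ.t1 a))
    rw [innerLink] at h3
    omega

/-! ### Sums over edge ends and the 2-colouring of corners -/

/-- The function on edge ends obtained by summing a flag function over the two sides. -/
def sideSum : (Φ → ZMod 2) →ₗ[ZMod 2] (Γ.toColex.EdgeOf 2 → ZMod 2) where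
  toFun f := Quot.lift (fun a => f a + f (Γ.t2 a)) (by
    rintro a b (h : b = Γ.t2 a)
    subst h
    rw [Γ.invol2, add_comm])
  map_add' f g := by
    funext h
    obtain ⟨a, rfl⟩ := Quot.exists_rep h
    exact add_add_add_comm _ _ _ _
  map_smul' c f := by
    funext h
    obtain ⟨a, rfl⟩ := Quot.exists_rep h
    exact (mul_add _ _ _).symm

theorem sideSum_edgeOf (f : Φ → ZMod 2) (a : Φ) :
    Γ.sideSum f (Γ.toColex.edgeOf 2 a) = f a + f (Γ.t2 a) := rfl

theorem sum_sideSum [Fintype Φ] [Fintype (Γ.toColex.EdgeOf 2)] (f : Φ → ZMod 2) :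
    ∑ h, Γ.sideSum f h = ∑ a, f a := by
  classical
  rw [← Finset.sum_fiberwise Finset.univ (Γ.toColex.edgeOf 2) f]
  refine Finset.sum_congr rfl fun h _ => ?_
  obtain ⟨a, rfl⟩ := Quot.exists_rep h
  have hfib : Finset.univ.filter (fun b => Γ.toColex.edgeOf 2 b = Quot.mk _ a) =
      {a, Γ.t2 a} := by
    ext b
    simp only [Finset.mem_filter, Finset.mem_univ, true_and, Finset.mem_insert,
      Finset.mem_singleton]
    rw [← Γ.tip_eq_iff]
    exact (Sum.inr_injective.eq_iff (a := Γ.toColex.edgeOf 2 b)).symm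
  rw [hfib, Finset.sum_pair (Γ.ne2 a).symm]
  exact Γ.sideSum_edgeOf f a

/-- A function on the vertices has zero sum over the edge ends when all degrees are even. -/
theorem sum_eq_zero_of_sideSum_mem [Fintype Φ] (hdeg : ∀ v : Γ.Vertex, Even (Γ.degree v))
    {w : Φ → ZMod 2} (hw : w + pullback Γ.t2 w ∈ invariants Γ.t1) : ∑ a, w a = 0 := by
  classical
  have : Fintype (Γ.toColex.EdgeOf 2) := Fintype.ofFinite _
  have : Finite Γ.Vertex := by
    unfold Vertex
    infer_instance
  have : Fintype Γ.Vertex := Fintype.ofFinite _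
  let vert : Γ.toColex.EdgeOf 2 → Γ.Vertex := Quot.lift Γ.vertex (by
    rintro a b (h : b = Γ.t2 a)
    exact Quot.sound (Or.inr h))
  rw [← Γ.sum_sideSum, ← Finset.sum_fiberwise Finset.univ vert]
  refine Finset.sum_eq_zero fun v _ => ?_
  obtain ⟨a, rfl⟩ := Quot.exists_rep v
  have hconst : ∀ h ∈ Finset.univ.filter (fun h => vert h = Quot.mk _ a),
      Γ.sideSum w h = w a + w (Γ.t2 a) := by
    intro h hh
    obtain ⟨b, rfl⟩ := Quot.exists_rep h
    have hb : Γ.vertex a = Γ.vertex b := ((Finset.mem_filter.1 hh).2 : Γ.vertex b = Γ.vertex a).symm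
    refine Γ.vertex_induction (P := fun c => w c + w (Γ.t2 c) = w a + w (Γ.t2 a)) ?_ ?_ hb rfl
    · intro c hc
      rw [← hc]
      exact hw c
    · intro c hc
      rw [← hc, Γ.invol2, add_comm]
  have hset : ((Finset.univ.filter (fun h => vert h = Quot.mk _ a) : Finset _) :
      Set (Γ.toColex.EdgeOf 2)) = Γ.edgeEnd '' {φ | Γ.vertex φ = Γ.vertex a} := by
    ext h
    simp only [Finset.coe_filter, Finset.mem_univ, true_and, Set.mem_ofPred_eq]
    constructor
    · intro hh
      obtain ⟨b, rfl⟩ := Quot.exists_rep h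
      exact ⟨b, hh, rfl⟩
    · rintro ⟨b, hb, rfl⟩
      exact hb
  have hcard : (Finset.univ.filter (fun h => vert h = Quot.mk _ a)).card = Γ.degree (Γ.vertex a) := by
    rw [← Set.ncard_coe_finset, hset]
    rfl
  rw [Finset.sum_congr rfl hconst, Finset.sum_const, hcard]
  obtain ⟨m, hm⟩ := hdeg (Γ.vertex a)
  rw [hm, add_smul, CharTwo.add_self_eq_zero]

/-- If all degrees are even, the corners can be 2-coloured so that the colours alternate around every
vertex.  By duality, the constant function `1` is a sum `q + q ∘ t2` with `q` invariant under `t1`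
as soon as it is orthogonal to every `w` with `w + w ∘ t2` invariant under `t1`. -/
theorem exists_corner_colouring [Finite Φ] (hdeg : ∀ v : Γ.Vertex, Even (Γ.degree v)) :
    ∃ q ∈ invariants Γ.t1, ∀ a, q (Γ.t2 a) = q a + 1 := by
  have : Fintype Φ := Fintype.ofFinite _
  let W := (invariants Γ.t1).map (LinearMap.id + pullback Γ.t2)
  have hmem : (fun _ => 1 : Φ → ZMod 2) ∈ W := by
    rw [← LinearMap.BilinForm.orthogonal_orthogonal (B := pairing Φ) pairing_nondegenerate
      pairing_isRefl W]
    intro w hw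
    have hw' : w + pullback Γ.t2 w ∈ invariants Γ.t1 := by
      rw [← orthogonal_invariants Γ.invol1 Γ.ne1]
      intro f hf
      have h := hw _ (Submodule.mem_map_of_mem hf)
      change pairing Φ (f + pullback Γ.t2 f) w = 0 at h
      change pairing Φ f (w + pullback Γ.t2 w) = 0
      rwa [map_add, LinearMap.add_apply, pairing_pullback Γ.invol2, ← map_add] at h
    have := Γ.sum_eq_zero_of_sideSum_mem hdeg hw'
    change pairing Φ w (fun _ => 1) = 0
    simpa [pairing_apply] using this
  obtain ⟨q, hq, hq1⟩ := hmem
  refine ⟨q, hq, fun a => ?_⟩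
  have h : q a + q (Γ.t2 a) = 1 := congrFun hq1 a
  rw [← h, ← add_assoc, CharTwo.add_self_eq_zero, zero_add]

end EmbeddedGraph

/-! ### Link colourings -/

/-- `X` or `Y`. -/
def PauliLetter.ofBit (c : ZMod 2) : PauliLetter := if c = 0 then X else Y

theorem PauliLetter.ofBit_ne_I : ∀ c, ofBit c ≠ I := by decide

theorem PauliLetter.ofBit_ne_Z : ∀ c, ofBit c ≠ Z := by decide

theorem PauliLetter.ofBit_ne_add_one : ∀ c, ofBit c ≠ ofBit (c + 1) := by decide

theorem PauliLetter.eq_ofBit : ∀ P, P ≠ I → P ≠ Z → P = ofBit (if P = X then 0 else 1) := by decide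

theorem PauliLetter.add_one_of_ofBit_ne : ∀ c d, ofBit c ≠ ofBit d → d = c + 1 := by decide

namespace EmbeddedGraph

variable {Φ : Type*} (Γ : EmbeddedGraph Φ)

/-- The colouring `col` is given by the colours `p` of the faces of the graph and `q` of the corners. -/
structure IsColourData (col : Set (Φ ⊕ Γ.toColex.EdgeOf 2) → PauliLetter) (p q : Φ → ZMod 2) :
    Prop where
  p0 : p ∈ invariants Γ.t0
  p1 : p ∈ invariants Γ.t1
  q1 : q ∈ invariants Γ.t1
  q2 : ∀ a, q (Γ.t2 a) = q a + 1
  link0 : ∀ a, col (Γ.link0 a) = PauliLetter.ofBit (p a)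
  link1 : ∀ a, col (Γ.link1 a) = PauliLetter.ofBit (p a + 1)
  innerLink : ∀ a, col (Γ.innerLink a) = PauliLetter.ofBit (q a)
  triangle : ∀ a, col (Γ.triangle a) = PauliLetter.Z

theorem IsColourData.isLinkColouring {Γ : EmbeddedGraph Φ}
    {col : Set (Φ ⊕ Γ.toColex.EdgeOf 2) → PauliLetter} {p q : Φ → ZMod 2}
    (h : Γ.IsColourData col p q) : Γ.subsystemHypergraph.IsLinkColouring col := by
  have hI := PauliLetter.ofBit_ne_I
  have hZ := PauliLetter.ofBit_ne_Z
  have hne := PauliLetter.ofBit_ne_add_one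
  refine ⟨?_, ?_, ?_⟩
  · intro e he
    rcases (Γ.mem_edgeSet_iff e).1 he with ⟨a, rfl⟩ | ⟨a, rfl⟩ | ⟨a, rfl⟩ | ⟨a, rfl⟩
    · rw [h.link0]
      exact hI _
    · rw [h.link1]
      exact hI _
    · rw [h.triangle]
      decide
    · rw [h.innerLink]
      exact hI _
  · intro e he h3
    obtain ⟨a, rfl⟩ := Γ.exists_triangle_of_ncard he h3
    exact h.triangle a
  · rintro e he e' he' hee ⟨v, hv, hv'⟩
    rcases v with a | v
    · rcases Γ.eq_of_inl_mem he hv with rfl | rfl | rfl <;>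
        rcases Γ.eq_of_inl_mem he' hv' with rfl | rfl | rfl <;>
        first
        | exact absurd rfl hee
        | simp only [h.link0, h.link1, h.triangle]
      exacts [hne _, hZ _, (hne _).symm, hZ _, (hZ _).symm, (hZ _).symm]
    · obtain ⟨a, rfl⟩ := Quot.exists_rep v
      rcases Γ.eq_of_tip_mem he hv with rfl | rfl | rfl <;>
        rcases Γ.eq_of_tip_mem he' hv' with rfl | rfl | rfl <;>
        first
        | exact absurd rfl hee
        | simp only [h.innerLink, h.triangle, h.q2]
      exacts [hne _, hZ _, (hne _).symm, hZ _, (hZ _).symm, (hZ _).symm]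

theorem exists_colourData [Finite Φ] (hloop : Γ.Loopless)
    (hdeg : ∀ v : Γ.Vertex, Even (Γ.degree v) ∧ 2 < Γ.degree v) :
    ∃ col p q, Γ.IsColourData col p q := by
  classical
  obtain ⟨q, hq1, hq2⟩ := Γ.exists_corner_colouring fun v => (hdeg v).1
  have hinner := Γ.innerLink_t2_ne fun v => (hdeg v).2
  have hl := Γ.link0_ne_link1 hloop
  let col : Set (Φ ⊕ Γ.toColex.EdgeOf 2) → PauliLetter := fun e =>
    if ∃ a, e = Γ.triangle a then PauliLetter.Z
    else if ∃ a, e = Γ.link0 a then PauliLetter.X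
    else if ∃ a, e = Γ.link1 a then PauliLetter.Y
    else if ∃ a, e = Γ.innerLink a ∧ q a = 0 then PauliLetter.X
    else PauliLetter.Y
  refine ⟨col, 0, q, zero_mem _, zero_mem _, hq1, hq2, fun a => ?_, fun a => ?_, fun a => ?_,
    fun a => ?_⟩
  · have h1 : ¬∃ b, Γ.link0 a = Γ.triangle b := fun ⟨b, hb⟩ => Γ.triangle_ne_link0 b a hb.symm
    have h2 : ∃ b, Γ.link0 a = Γ.link0 b := ⟨a, rfl⟩
    simp only [col, if_neg h1, if_pos h2]
    rfl
  · have h1 : ¬∃ b, Γ.link1 a = Γ.triangle b := fun ⟨b, hb⟩ => Γ.triangle_ne_link1 b a hb.symm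
    have h2 : ¬∃ b, Γ.link1 a = Γ.link0 b := fun ⟨b, hb⟩ => hl b a hb.symm
    have h3 : ∃ b, Γ.link1 a = Γ.link1 b := ⟨a, rfl⟩
    simp only [col, if_neg h1, if_neg h2, if_pos h3]
    rfl
  · have h1 : ¬∃ b, Γ.innerLink a = Γ.triangle b :=
      fun ⟨b, hb⟩ => Γ.triangle_ne_innerLink b a hb.symm
    have h2 : ¬∃ b, Γ.innerLink a = Γ.link0 b := fun ⟨b, hb⟩ => Γ.innerLink_ne_link0 a b hb
    have h3 : ¬∃ b, Γ.innerLink a = Γ.link1 b := fun ⟨b, hb⟩ => Γ.innerLink_ne_link1 a b hb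
    have h4 : (∃ b, Γ.innerLink a = Γ.innerLink b ∧ q b = 0) ↔ q a = 0 := by
      constructor
      · rintro ⟨b, hb, hq⟩
        rcases (hb ▸ Γ.tip_mem_innerLink a : Γ.tip a ∈ Γ.innerLink b) with h | h <;>
          rcases (Γ.tip_eq_iff _ _).1 h with rfl | rfl
        · exact hq
        · exact absurd hb.symm (hinner b)
        · rw [hq1, hq]
        · rw [← Γ.innerLink_t1 b] at hb
          exact absurd hb.symm (hinner (Γ.t1 b))
      · exact fun h => ⟨a, rfl, h⟩
    simp only [col, if_neg h1, if_neg h2, if_neg h3, h4]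
    rfl
  · have h1 : ∃ b, Γ.triangle a = Γ.triangle b := ⟨a, rfl⟩
    simp only [col, if_pos h1]

theorem exists_colourData_of_isLinkColouring (hloop : Γ.Loopless)
    (hdeg : ∀ v : Γ.Vertex, 2 < Γ.degree v)
    {col : Set (Φ ⊕ Γ.toColex.EdgeOf 2) → PauliLetter}
    (hcol : Γ.subsystemHypergraph.IsLinkColouring col) : ∃ p q, Γ.IsColourData col p q := by
  obtain ⟨hI, h3, hne⟩ := hcol
  have htri : ∀ a, col (Γ.triangle a) = PauliLetter.Z :=
    fun a => h3 _ (Γ.triangle_mem a) (Γ.ncard_triangle a)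
  have hZ0 : ∀ a, col (Γ.link0 a) ≠ PauliLetter.Z := fun a => by
    rw [← htri a]
    exact hne _ (Γ.link0_mem a) _ (Γ.triangle_mem a) (Γ.triangle_ne_link0 a a).symm
      ⟨_, Γ.inl_mem_link0 a, Γ.inl_mem_triangle a⟩
  have hZ1 : ∀ a, col (Γ.link1 a) ≠ PauliLetter.Z := fun a => by
    rw [← htri a]
    exact hne _ (Γ.link1_mem a) _ (Γ.triangle_mem a) (Γ.triangle_ne_link1 a a).symm
      ⟨_, Γ.inl_mem_link1 a, Γ.inl_mem_triangle a⟩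
  have hZi : ∀ a, col (Γ.innerLink a) ≠ PauliLetter.Z := fun a => by
    rw [← htri a]
    exact hne _ (Γ.innerLink_mem a) _ (Γ.triangle_mem a) (Γ.triangle_ne_innerLink a a).symm
      ⟨_, Γ.tip_mem_innerLink a, Γ.tip_mem_triangle a⟩
  let bit : PauliLetter → ZMod 2 := fun P => if P = PauliLetter.X then 0 else 1
  have hb0 : ∀ a, col (Γ.link0 a) = PauliLetter.ofBit (bit (col (Γ.link0 a))) :=
    fun a => PauliLetter.eq_ofBit _ (hI _ (Γ.link0_mem a)) (hZ0 a)
  have hb1 : ∀ a, col (Γ.link1 a) = PauliLetter.ofBit (bit (col (Γ.link1 a))) :=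
    fun a => PauliLetter.eq_ofBit _ (hI _ (Γ.link1_mem a)) (hZ1 a)
  have hbi : ∀ a, col (Γ.innerLink a) = PauliLetter.ofBit (bit (col (Γ.innerLink a))) :=
    fun a => PauliLetter.eq_ofBit _ (hI _ (Γ.innerLink_mem a)) (hZi a)
  have h01 : ∀ a, bit (col (Γ.link1 a)) = bit (col (Γ.link0 a)) + 1 := fun a => by
    refine PauliLetter.add_one_of_ofBit_ne _ _ ?_
    rw [← hb0, ← hb1]
    exact hne _ (Γ.link0_mem a) _ (Γ.link1_mem a) (Γ.link0_ne_link1 hloop a a)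
      ⟨_, Γ.inl_mem_link0 a, Γ.inl_mem_link1 a⟩
  refine ⟨fun a => bit (col (Γ.link0 a)), fun a => bit (col (Γ.innerLink a)), ?_, ?_, ?_, ?_, hb0,
    ?_, hbi, htri⟩
  · intro a
    simp only [link0_t0]
  · intro a
    refine add_right_cancel (b := 1) ?_
    simp only [← h01, link1_t1]
  · intro a
    simp only [innerLink_t1]
  · intro a
    refine PauliLetter.add_one_of_ofBit_ne _ _ ?_
    rw [← hbi, ← hbi]
    exact hne _ (Γ.innerLink_mem a) _ (Γ.innerLink_mem _) (Γ.innerLink_t2_ne hdeg a)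
      ⟨_, Γ.tip_mem_innerLink a, Γ.tip_t2 a ▸ Γ.tip_mem_innerLink _⟩
  · intro a
    simp only [← h01]
    exact hb1 a

end EmbeddedGraph

/-! ### The centralizer of the gauge group of a hypergraph -/

namespace PauliLetter

/-- The symplectic form on the vectors of Pauli matrices. -/
def charge (P : PauliLetter) (y : ZMod 2 × ZMod 2) : ZMod 2 := P.vec.1 * y.2 + P.vec.2 * y.1

theorem charge_vec : ∀ P Q : PauliLetter, charge P Q.vec = comm P Q := by decide

theorem charge_Z (y : ZMod 2 × ZMod 2) : charge Z y = y.1 := by simp [charge, vec]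

theorem charge_ofBit : ∀ (c : ZMod 2) (y : ZMod 2 × ZMod 2), charge (ofBit c) y = y.2 + c * y.1 := by
  decide

end PauliLetter

namespace Pauli

variable {V : Type*}

open Classical in
theorem vec_on (P : PauliLetter) (s : Set V) (v : V) : (on P s).vec v = if v ∈ s then P.vec else 0 := by
  change PauliLetter.vec (if v ∈ s then P else PauliLetter.I) = _
  split_ifs <;> rfl

open Classical in
theorem symplecticForm_on [Fintype V] (P : PauliLetter) (s : Set V) (x : V → ZMod 2 × ZMod 2) :
    symplecticForm V (on P s).vec x = ∑ v with v ∈ s, P.charge (x v) := by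
  rw [symplecticForm_apply, Finset.sum_filter]
  refine Finset.sum_congr rfl fun v _ => ?_
  rw [vec_on]
  split_ifs
  · rfl
  · simp

theorem symplecticForm_on_pair [Fintype V] (P : PauliLetter) {u v : V} (huv : u ≠ v)
    (x : V → ZMod 2 × ZMod 2) :
    symplecticForm V (on P {u, v}).vec x = P.charge (x u) + P.charge (x v) := by
  classical
  rw [symplecticForm_on, ← Finset.sum_pair (f := fun w => P.charge (x w)) huv]
  congr 1
  ext w
  simp

theorem weight_on {P : PauliLetter} (hP : P ≠ PauliLetter.I) (s : Set V) :
    (on P s).weight = s.ncard := by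
  classical
  unfold weight on
  congr 1
  ext v
  by_cases h : v ∈ s <;> simp [h, hP]

end Pauli

namespace Hypergraph

variable {V : Type*} [Fintype V] (H : Hypergraph V) {col : Set V → PauliLetter}

theorem scalarI_mem_gaugeGroup (col : Set V → PauliLetter) : Pauli.scalarI ∈ H.gaugeGroup col :=
  Subgroup.subset_closure (Set.mem_insert _ _)

theorem isTwoLocal_gaugeGroup (hcol : ∀ e ∈ H.edgeSet, col e ≠ PauliLetter.I) :
    SubsystemCode.IsTwoLocal (H.gaugeGroup col) := by
  refine ⟨_, ?_, rfl⟩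
  rintro p ⟨e, he, u, -, v, -, huv, rfl⟩
  rw [Pauli.weight_on (hcol e he), Set.ncard_pair huv]

/-- An operator is in the centralizer of the gauge group if and only if its commutation with the
matrix of an edge is the same at all vertices of the edge. -/
theorem vec_mem_centralizer_iff (x : V → ZMod 2 × ZMod 2) :
    x ∈ SubsystemCode.space (SubsystemCode.centralizer (H.gaugeGroup col)) ↔
      ∀ e ∈ H.edgeSet, ∀ u ∈ e, ∀ v ∈ e, (col e).charge (x u) = (col e).charge (x v) := by
  obtain ⟨p, rfl⟩ := Pauli.exists_vec_eq x
  have hp : p.vec ∈ SubsystemCode.space (SubsystemCode.centralizer (H.gaugeGroup col)) ↔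
      p ∈ SubsystemCode.centralizer (H.gaugeGroup col) := by
    refine SubsystemCode.vec_mem_space_iff (SubsystemCode.mem_centralizer_iff.2 fun q _ => ?_)
    rw [symplecticForm_comm]
    simp [symplecticForm_apply, Pauli.vec, Pauli.scalarI, PauliLetter.vec]
  rw [hp, SubsystemCode.centralizer, gaugeGroup, Subgroup.centralizer_closure,
    Subgroup.mem_centralizer_iff]
  constructor
  · intro h e he u hu v hv
    by_cases huv : u = v
    · rw [huv]
    · have := h _ (Or.inr ⟨e, he, u, hu, v, hv, huv, rfl⟩)
      rw [Pauli.commute_iff, Pauli.symplecticForm_on_pair _ huv] at this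
      exact CharTwo.add_eq_zero.1 this
  · rintro h q (rfl | ⟨e, he, u, hu, v, hv, huv, rfl⟩)
    · rw [Pauli.commute_iff]
      simp [symplecticForm_apply, Pauli.vec, Pauli.scalarI, PauliLetter.vec]
    · rw [Pauli.commute_iff, Pauli.symplecticForm_on_pair _ huv, h e he u hu v hv]
      exact CharTwo.add_self_eq_zero _

end Hypergraph

/-! ### The cycle space as the space of the centralizer -/

namespace EmbeddedGraph

variable {Φ : Type*} (Γ : EmbeddedGraph Φ)

/-- The vector of the Pauli operator that anticommutes, at each vertex, with the matrix of an edge there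
exactly when that edge belongs to the hypercycle encoded by `(s, g)`; the colours are those given
by `p` and `q`. -/
def cycleVec (p q : Φ → ZMod 2) :
    ((Φ → ZMod 2) × (Φ → ZMod 2)) →ₗ[ZMod 2] (Φ ⊕ Γ.toColex.EdgeOf 2 → ZMod 2 × ZMod 2) where
  toFun x := Sum.elim
    (fun a => (x.2 a + x.2 (Γ.t2 a), x.1 a + p a * (x.2 a + x.2 (Γ.t2 a))))
    (fun h => (Γ.sideSum x.2 h, Γ.sideSum (pullback Γ.t2 q * x.2) h))
  map_add' x y := by
    funext v
    rcases v with a | h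
    · simp only [Sum.elim_inl, Pi.add_apply, Prod.fst_add, Prod.snd_add, Prod.mk_add_mk]
      exact Prod.ext (by ring) (by ring)
    · simp only [Sum.elim_inr, Pi.add_apply, Prod.fst_add, Prod.snd_add, Prod.mk_add_mk, mul_add,
        map_add]
  map_smul' c x := by
    funext v
    rcases v with a | h
    · simp only [Sum.elim_inl, Pi.smul_apply, Prod.smul_fst, Prod.smul_snd, Prod.smul_mk,
        smul_eq_mul, RingHom.id_apply]
      exact Prod.ext (by ring) (by ring)
    · simp only [Sum.elim_inr, Pi.smul_apply, Prod.smul_fst, Prod.smul_snd, Prod.smul_mk,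
        RingHom.id_apply, mul_smul_comm, map_smul]

theorem cycleVec_inl (p q : Φ → ZMod 2) (x : (Φ → ZMod 2) × (Φ → ZMod 2)) (a : Φ) :
    Γ.cycleVec p q x (Sum.inl a) =
      (x.2 a + x.2 (Γ.t2 a), x.1 a + p a * (x.2 a + x.2 (Γ.t2 a))) := rfl

theorem cycleVec_tip (p : Φ → ZMod 2) {q : Φ → ZMod 2} (hq : ∀ a, q (Γ.t2 a) = q a + 1)
    (x : (Φ → ZMod 2) × (Φ → ZMod 2)) (a : Φ) :
    Γ.cycleVec p q x (Γ.tip a) =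
      (x.2 a + x.2 (Γ.t2 a), x.2 a + q a * (x.2 a + x.2 (Γ.t2 a))) := by
  change (Γ.sideSum x.2 (Γ.toColex.edgeOf 2 a),
    Γ.sideSum (pullback Γ.t2 q * x.2) (Γ.toColex.edgeOf 2 a)) = _
  rw [sideSum_edgeOf, sideSum_edgeOf, Pi.mul_apply, Pi.mul_apply, pullback_apply, pullback_apply,
    Γ.invol2, hq]
  exact Prod.ext rfl (by ring)

theorem cycleVec_injective (p : Φ → ZMod 2) {q : Φ → ZMod 2} (hq : ∀ a, q (Γ.t2 a) = q a + 1) :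
    Function.Injective (Γ.cycleVec p q) := by
  rw [← LinearMap.ker_eq_bot, LinearMap.ker_eq_bot']
  intro x hx
  have hl : ∀ a, Γ.cycleVec p q x (Sum.inl a) = 0 := fun a => congrFun hx _
  have hr : ∀ a, Γ.cycleVec p q x (Γ.tip a) = 0 := fun a => congrFun hx _
  refine Prod.ext (funext fun a => ?_) (funext fun a => ?_)
  · have h := hl a
    rw [cycleVec_inl] at h
    have h1 := congrArg Prod.fst h
    have h2 := congrArg Prod.snd h
    simp only [Prod.fst_zero, Prod.snd_zero] at h1 h2
    rwa [h1, mul_zero, add_zero] at h2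
  · have h := hr a
    rw [cycleVec_tip _ _ hq] at h
    have h1 := congrArg Prod.fst h
    have h2 := congrArg Prod.snd h
    simp only [Prod.fst_zero, Prod.snd_zero] at h1 h2
    rwa [h1, mul_zero, add_zero] at h2

/-- The commutation conditions of the centralizer on the flags, one for each kind of edge. -/
theorem mem_centralizer_iff [Finite Φ] {col : Set (Φ ⊕ Γ.toColex.EdgeOf 2) → PauliLetter}
    {p q : Φ → ZMod 2} (hc : Γ.IsColourData col p q)
    (y : Φ ⊕ Γ.toColex.EdgeOf 2 → ZMod 2 × ZMod 2) :
    y ∈ SubsystemCode.space (SubsystemCode.centralizer (Γ.subsystemHypergraph.gaugeGroup col)) ↔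
      (∀ a, (y (Sum.inl (Γ.t0 a))).2 + p a * (y (Sum.inl (Γ.t0 a))).1 =
        (y (Sum.inl a)).2 + p a * (y (Sum.inl a)).1) ∧
      (∀ a, (y (Sum.inl (Γ.t1 a))).2 + (p a + 1) * (y (Sum.inl (Γ.t1 a))).1 =
        (y (Sum.inl a)).2 + (p a + 1) * (y (Sum.inl a)).1) ∧
      (∀ a, (y (Sum.inl a)).1 = (y (Γ.tip a)).1) ∧
      ∀ a, (y (Γ.tip (Γ.t1 a))).2 + q a * (y (Γ.tip (Γ.t1 a))).1 =
        (y (Γ.tip a)).2 + q a * (y (Γ.tip a)).1 := by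
  rw [Hypergraph.vec_mem_centralizer_iff]
  constructor
  · intro h
    refine ⟨fun a => ?_, fun a => ?_, fun a => ?_, fun a => ?_⟩
    · have := h _ (Γ.link0_mem a) _ (Or.inr rfl) _ (Or.inl rfl)
      rwa [hc.link0, PauliLetter.charge_ofBit, PauliLetter.charge_ofBit] at this
    · have := h _ (Γ.link1_mem a) _ (Or.inr rfl) _ (Or.inl rfl)
      rwa [hc.link1, PauliLetter.charge_ofBit, PauliLetter.charge_ofBit] at this
    · have := h _ (Γ.triangle_mem a) _ (Γ.inl_mem_triangle a) _ (Γ.tip_mem_triangle a)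
      rwa [hc.triangle, PauliLetter.charge_Z, PauliLetter.charge_Z] at this
    · have := h _ (Γ.innerLink_mem a) _ (Or.inr rfl) _ (Or.inl rfl)
      rwa [hc.innerLink, PauliLetter.charge_ofBit, PauliLetter.charge_ofBit] at this
  · rintro ⟨h0, h1, h2, hi⟩ e he
    -- It suffices to compare every vertex of an edge with one of them.
    suffices hs : ∃ c, ∀ u ∈ e, (col e).charge (y u) = c by
      obtain ⟨c, hs⟩ := hs
      exact fun u hu v hv => (hs u hu).trans (hs v hv).symm
    rcases (Γ.mem_edgeSet_iff e).1 he with ⟨a, rfl⟩ | ⟨a, rfl⟩ | ⟨a, rfl⟩ | ⟨a, rfl⟩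
    · rw [hc.link0]
      simp only [PauliLetter.charge_ofBit]
      refine ⟨(y (Sum.inl a)).2 + p a * (y (Sum.inl a)).1, ?_⟩
      rintro u (rfl | rfl)
      exacts [rfl, h0 a]
    · rw [hc.link1]
      simp only [PauliLetter.charge_ofBit]
      refine ⟨(y (Sum.inl a)).2 + (p a + 1) * (y (Sum.inl a)).1, ?_⟩
      rintro u (rfl | rfl)
      exacts [rfl, h1 a]
    · rw [hc.triangle]
      simp only [PauliLetter.charge_Z]
      refine ⟨(y (Γ.tip a)).1, ?_⟩
      rintro u (rfl | rfl | rfl)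
      exacts [h2 a, (h2 _).trans (by rw [tip_t2]), rfl]
    · rw [hc.innerLink]
      simp only [PauliLetter.charge_ofBit]
      refine ⟨(y (Γ.tip a)).2 + q a * (y (Γ.tip a)).1, ?_⟩
      rintro u (rfl | rfl)
      exacts [rfl, hi a]

theorem map_cycleVec_cycleSpace [Finite Φ] {col : Set (Φ ⊕ Γ.toColex.EdgeOf 2) → PauliLetter}
    {p q : Φ → ZMod 2} (hc : Γ.IsColourData col p q) :
    Γ.cycleSpace.map (Γ.cycleVec p q) =
      SubsystemCode.space
        (SubsystemCode.centralizer (Γ.subsystemHypergraph.gaugeGroup col)) := by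
  have h2 : ∀ u : ZMod 2, u + u = 0 := CharTwo.add_self_eq_zero
  ext y
  rw [Γ.mem_centralizer_iff hc]
  constructor
  · rintro ⟨x, ⟨hx0, hx1, hx2⟩, rfl⟩
    refine ⟨fun a => ?_, fun a => ?_, fun a => ?_, fun a => ?_⟩
    · simp only [cycleVec_inl, hc.p0 a, add_assoc, h2, add_zero]
      exact hx0 a
    · have h := hx1 a
      simp only [Pi.add_apply, pullback_apply] at h
      simp only [cycleVec_inl, hc.p1 a]
      have hg := hx2 a
      linear_combination h + hg + h2 (p a * (x.2 (Γ.t1 a) + x.2 (Γ.t2 (Γ.t1 a)))) -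
        h2 (p a * (x.2 a + x.2 (Γ.t2 a)))
    · rw [cycleVec_inl, Γ.cycleVec_tip _ hc.q2]
    · simp only [Γ.cycleVec_tip _ hc.q2, hc.q1 a, add_assoc, h2, add_zero]
      exact hx2 a
  · rintro ⟨h0, h1, ht, hi⟩
    let s : Φ → ZMod 2 := fun a => (y (Sum.inl a)).2 + p a * (y (Sum.inl a)).1
    let g : Φ → ZMod 2 := fun a => (y (Γ.tip a)).2 + q a * (y (Γ.tip a)).1
    have hT : ∀ a, g a + g (Γ.t2 a) = (y (Γ.tip a)).1 := fun a => by
      simp only [g, tip_t2, hc.q2]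
      linear_combination h2 (y (Γ.tip a)).2 + h2 (q a * (y (Γ.tip a)).1)
    have hs : s ∈ invariants Γ.t0 := fun a => by
      simp only [s, hc.p0 a]
      exact h0 a
    have hg : g ∈ invariants Γ.t1 := fun a => by
      simp only [g, hc.q1 a]
      exact hi a
    have hu : s + pullback Γ.t2 g ∈ invariants Γ.t1 := fun a => by
      have e1 : g (Γ.t2 (Γ.t1 a)) = g (Γ.t1 a) + (y (Sum.inl (Γ.t1 a))).1 := by
        rw [ht, ← hT, ← add_assoc, h2, zero_add]
      have e2 : g (Γ.t2 a) = g a + (y (Sum.inl a)).1 := by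
        rw [ht, ← hT, ← add_assoc, h2, zero_add]
      simp only [Pi.add_apply, pullback_apply, e1, e2, hg a, s, hc.p1 a]
      linear_combination h1 a
    refine ⟨(s, g), ⟨hs, hu, hg⟩, funext fun v => ?_⟩
    rcases v with a | v
    · simp only [cycleVec_inl, hT, ← ht, s]
      exact Prod.ext rfl (by simp only [add_assoc, h2, add_zero])
    · obtain ⟨a, rfl⟩ := Quot.exists_rep v
      change Γ.cycleVec p q (s, g) (Γ.tip a) = y (Γ.tip a)
      rw [Γ.cycleVec_tip _ hc.q2]
      simp only [hT, g]
      exact Prod.ext rfl (by simp only [add_assoc, h2, add_zero])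

theorem symplecticForm_cycleVec [Fintype Φ] {p q : Φ → ZMod 2} (hq : ∀ a, q (Γ.t2 a) = q a + 1)
    {x y : (Φ → ZMod 2) × (Φ → ZMod 2)} (hx : x ∈ Γ.cycleSpace) (hy : y ∈ Γ.cycleSpace) :
    symplecticForm _ (Γ.cycleVec p q x) (Γ.cycleVec p q y) = Γ.cycleForm x y := by
  have h2 : ∀ u : ZMod 2, u + u = 0 := CharTwo.add_self_eq_zero
  have : Fintype (Γ.toColex.EdgeOf 2) := Fintype.ofFinite _
  have hsplit : symplecticForm _ (Γ.cycleVec p q x) (Γ.cycleVec p q y) =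
      (∑ a, ((Γ.cycleVec p q x (Sum.inl a)).1 * (Γ.cycleVec p q y (Sum.inl a)).2 +
        (Γ.cycleVec p q x (Sum.inl a)).2 * (Γ.cycleVec p q y (Sum.inl a)).1)) +
      ∑ h, ((Γ.cycleVec p q x (Sum.inr h)).1 * (Γ.cycleVec p q y (Sum.inr h)).2 +
        (Γ.cycleVec p q x (Sum.inr h)).2 * (Γ.cycleVec p q y (Sum.inr h)).1) := by
    rw [symplecticForm_apply]
    convert Fintype.sum_sum_type (fun v => (Γ.cycleVec p q x v).1 * (Γ.cycleVec p q y v).2 +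
      (Γ.cycleVec p q x v).2 * (Γ.cycleVec p q y v).1)
  -- The products of the two indicator functions of `t0`-edges, of `t1`-edges and of rank-3 edges are
  -- invariant under `t0`, `t1` and `t2` respectively, so each sums to zero over the flags.
  obtain ⟨hx0, hx1, hx2⟩ := hx
  obtain ⟨hy0, hy1, hy2⟩ := hy
  have hT : ∀ f : Φ → ZMod 2, f + pullback Γ.t2 f ∈ invariants Γ.t2 := fun f a => by
    simp only [Pi.add_apply, pullback_apply, Γ.invol2 a]
    exact add_comm _ _
  have z0 := sum_eq_zero_of_mem_invariants Γ.invol0 Γ.ne0 (mul_mem_invariants hx0 hy0)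
  have z1 := sum_eq_zero_of_mem_invariants Γ.invol1 Γ.ne1
    (mul_mem_invariants (add_mem hx1 hx2) (add_mem hy1 hy2))
  have z2 := sum_eq_zero_of_mem_invariants Γ.invol2 Γ.ne2 (mul_mem_invariants (hT x.2) (hT y.2))
  have hleft : ∑ a, ((Γ.cycleVec p q x (Sum.inl a)).1 * (Γ.cycleVec p q y (Sum.inl a)).2 +
      (Γ.cycleVec p q x (Sum.inl a)).2 * (Γ.cycleVec p q y (Sum.inl a)).1) = 0 := by
    have hsum : ∑ a, ((Γ.cycleVec p q x (Sum.inl a)).1 * (Γ.cycleVec p q y (Sum.inl a)).2 +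
        (Γ.cycleVec p q x (Sum.inl a)).2 * (Γ.cycleVec p q y (Sum.inl a)).1) =
        ∑ a, (((x.1 + pullback Γ.t2 x.2 + x.2) * (y.1 + pullback Γ.t2 y.2 + y.2)) a +
          (x.1 * y.1) a + ((x.2 + pullback Γ.t2 x.2) * (y.2 + pullback Γ.t2 y.2)) a) := by
      refine Finset.sum_congr rfl fun a _ => ?_
      simp only [cycleVec_inl, Pi.add_apply, Pi.mul_apply, pullback_apply]
      linear_combination h2 (p a * (x.2 a + x.2 (Γ.t2 a)) * (y.2 a + y.2 (Γ.t2 a))) -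
        h2 (x.1 a * y.1 a) - h2 ((x.2 a + x.2 (Γ.t2 a)) * (y.2 a + y.2 (Γ.t2 a)))
    rw [hsum, Finset.sum_add_distrib, Finset.sum_add_distrib, z0, z1, z2, add_zero, add_zero]
  rw [hsplit, hleft, zero_add, cycleForm, pairing_apply]
  refine Eq.trans ?_ (Γ.sum_sideSum (x.2 * pullback Γ.t2 y.2))
  refine Finset.sum_congr rfl fun h _ => ?_
  obtain ⟨a, rfl⟩ := Quot.exists_rep h
  change (Γ.cycleVec p q x (Γ.tip a)).1 * (Γ.cycleVec p q y (Γ.tip a)).2 +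
    (Γ.cycleVec p q x (Γ.tip a)).2 * (Γ.cycleVec p q y (Γ.tip a)).1 =
    Γ.sideSum (x.2 * pullback Γ.t2 y.2) (Γ.toColex.edgeOf 2 a)
  rw [Γ.cycleVec_tip _ hq, Γ.cycleVec_tip _ hq, sideSum_edgeOf]
  simp only [Pi.mul_apply, pullback_apply, Γ.invol2 a]
  linear_combination h2 (x.2 a * y.2 a) +
    h2 (q a * (x.2 a + x.2 (Γ.t2 a)) * (y.2 a + y.2 (Γ.t2 a)))

theorem map_cycleVec_cornerRadical [Finite Φ]
    {col : Set (Φ ⊕ Γ.toColex.EdgeOf 2) → PauliLetter} {p q : Φ → ZMod 2}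
    (hc : Γ.IsColourData col p q) :
    (Γ.cyclesOver Γ.cornerRadical).map (Γ.cycleVec p q) =
      SubsystemCode.space
        (SubsystemCode.stabilizer (Γ.subsystemHypergraph.gaugeGroup col)) := by
  have : Fintype Φ := Fintype.ofFinite _
  rw [SubsystemCode.space_stabilizer (Hypergraph.scalarI_mem_gaugeGroup _ _)]
  ext v
  rw [Submodule.mem_inf, SubsystemCode.mem_space_iff, ← Γ.map_cycleVec_cycleSpace hc]
  constructor
  · rintro ⟨x, hx, rfl⟩
    obtain ⟨hx, hrad⟩ := (Γ.mem_cyclesOver_cornerRadical_iff x).1 hx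
    refine ⟨?_, x, hx, rfl⟩
    rintro _ ⟨y, hy, rfl⟩
    rw [Γ.symplecticForm_cycleVec hc.q2 hy hx]
    exact hrad y hy
  · rintro ⟨h, x, hx, rfl⟩
    refine ⟨x, (Γ.mem_cyclesOver_cornerRadical_iff x).2 ⟨hx, fun y hy => ?_⟩, rfl⟩
    rw [← Γ.symplecticForm_cycleVec (p := p) hc.q2 hy hx]
    exact h _ ⟨y, hy, rfl⟩

theorem exists_hasParameters [Finite Φ] {col : Set (Φ ⊕ Γ.toColex.EdgeOf 2) → PauliLetter}
    {p q : Φ → ZMod 2} (hc : Γ.IsColourData col p q) :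
    ∃ k r : ℕ,
      (k : ℤ) = 1 + Γ.dualBipartiteIndicator - Γ.eulerChar ∧
      (r : ℤ) = 4 * (Γ.numEdges : ℤ) - Γ.eulerChar ∧
      SubsystemCode.HasParameters (Γ.subsystemHypergraph.gaugeGroup col)
        (6 * Γ.numEdges) k r := by
  have : Fintype Φ := Fintype.ofFinite _
  have hinj := Γ.cycleVec_injective p hc.q2
  have hG := Γ.subsystemHypergraph.scalarI_mem_gaugeGroup col
  set G := Γ.subsystemHypergraph.gaugeGroup col with hGdef
  have hC : Module.finrank (ZMod 2) (SubsystemCode.space (SubsystemCode.centralizer G)) =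
      2 * Γ.numEdges + Module.finrank (ZMod 2) Γ.faceColourings := by
    rw [← Γ.map_cycleVec_cycleSpace hc, ← Γ.finrank_cycleSpace]
    exact (Submodule.equivMapOfInjective _ hinj _).finrank_eq.symm
  have hS : Module.finrank (ZMod 2) (SubsystemCode.space (SubsystemCode.stabilizer G)) +
      Module.finrank (ZMod 2) Γ.faceColourings =
      2 * Nat.card Γ.Face + 2 * Nat.card Γ.Vertex := by
    rw [← Γ.map_cycleVec_cornerRadical hc, ← Γ.finrank_cyclesOver_cornerRadical hc.q1 hc.q2]
    congr 1
    exact (Submodule.equivMapOfInjective _ hinj _).finrank_eq.symm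
  have hn : 6 * Γ.numEdges = Fintype.card (Φ ⊕ Γ.toColex.EdgeOf 2) := by
    rw [← Nat.card_eq_fintype_card, Nat.card_sum, Γ.card_edgeOf_two, Nat.card_eq_fintype_card,
      Γ.card_eq_four_mul_numEdges]
    ring
  have hGC := finrank_add_finrank_symplectic_orthogonal (SubsystemCode.space G)
  rw [← SubsystemCode.space_centralizer, ← hn] at hGC
  have hst := SubsystemCode.space_stabilizer hG
  have hle1 : Module.finrank (ZMod 2) (SubsystemCode.space (SubsystemCode.stabilizer G)) ≤
      Module.finrank (ZMod 2) (SubsystemCode.space (SubsystemCode.centralizer G)) :=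
    Submodule.finrank_mono (by rw [hst]; exact inf_le_right)
  have hle2 : Module.finrank (ZMod 2) (SubsystemCode.space (SubsystemCode.stabilizer G)) ≤
      Module.finrank (ZMod 2) (SubsystemCode.space G) :=
    Submodule.finrank_mono (by rw [hst]; exact inf_le_left)
  have hz := Γ.finrank_faceColourings
  have hE : Γ.numEdges = Nat.card Γ.Edge := rfl
  refine ⟨(1 + Γ.dualBipartiteIndicator - Γ.eulerChar).toNat,
    (4 * (Γ.numEdges : ℤ) - Γ.eulerChar).toNat, ?_, ?_, ?_⟩
  · rw [Int.toNat_of_nonneg]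
    rw [eulerChar]
    omega
  · rw [Int.toNat_of_nonneg]
    rw [eulerChar]
    omega
  · refine SubsystemCode.hasParameters_of_finrank hG hn (s := Module.finrank (ZMod 2)
      (SubsystemCode.space (SubsystemCode.stabilizer G))) ?_ ?_ rfl
    · rw [eulerChar]
      omega
    · rw [eulerChar]
      omega

end EmbeddedGraph

/-! ### Operators of hypercycles and the distance -/

namespace Hypergraph

variable {V : Type*} [Fintype V] {H : Hypergraph V} {col : Set V → PauliLetter}

theorem vec_cycleOperator (col : Set V → PauliLetter) (σ : Set (Set V)) :
    (cycleOperator col σ).vec = ∑ e ∈ (Set.toFinite σ).toFinset, (Pauli.on (col e) e).vec := by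
  rw [cycleOperator, Pauli.vec_list_prod, List.map_map, ← Finset.sum_map_toList]
  rfl

/-- The operator of a hypercycle anticommutes with the matrix of an edge, at each of the vertices of that
edge, if and only if the edge belongs to the hypercycle. -/
theorem vec_cycleOperator_mem (hcol : H.IsLinkColouring col) {σ : Set (Set V)}
    (hσ : H.IsHypercycle σ) :
    (cycleOperator col σ).vec ∈
      SubsystemCode.space (SubsystemCode.centralizer (H.gaugeGroup col)) := by
  classical
  obtain ⟨hI, -, hne⟩ := hcol
  obtain ⟨hsub, heven⟩ := hσ
  rw [vec_mem_centralizer_iff]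
  intro e he
  suffices hs : ∀ u ∈ e, (col e).charge ((cycleOperator col σ).vec u) = if e ∈ σ then 1 else 0 from
    fun u hu v hv => (hs u hu).trans (hs v hv).symm
  intro u hu
  have hadd : ∀ (P : PauliLetter) (y z : ZMod 2 × ZMod 2),
      P.charge (y + z) = P.charge y + P.charge z := by
    intro P y z
    simp only [PauliLetter.charge, Prod.fst_add, Prod.snd_add]
    ring
  let chargeHom : ZMod 2 × ZMod 2 →+ ZMod 2 := AddMonoidHom.mk' (col e).charge (hadd _)
  have hcard : ((Set.toFinite σ).toFinset.filter (fun f => u ∈ f)).card =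
      {f ∈ σ | u ∈ f}.ncard := by
    rw [← Set.ncard_coe_finset]
    congr 1
    ext f
    simp
  change chargeHom _ = _
  rw [vec_cycleOperator, Finset.sum_apply, map_sum]
  have hterm : ∀ f ∈ (Set.toFinite σ).toFinset, chargeHom ((Pauli.on (col f) f).vec u) =
      if u ∈ f then (1 + if f = e then 1 else 0) else 0 := by
    intro f hf
    have hfσ : f ∈ σ := (Set.toFinite σ).mem_toFinset.1 hf
    rw [Pauli.vec_on]
    split_ifs with hu' hfe
    · change (col e).charge _ = _
      rw [PauliLetter.charge_vec, PauliLetter.comm_eq_ite _ _ (hI e he) (hI f (hsub hfσ)), hfe,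
        if_pos rfl, CharTwo.add_self_eq_zero]
    · change (col e).charge _ = _
      rw [PauliLetter.charge_vec, PauliLetter.comm_eq_ite _ _ (hI e he) (hI f (hsub hfσ)),
        if_neg (hne e he f (hsub hfσ) (Ne.symm hfe) ⟨u, hu, hu'⟩), add_zero]
    · exact map_zero _
  rw [Finset.sum_congr rfl hterm, ← Finset.sum_filter, Finset.sum_add_distrib, Finset.sum_const,
    hcard, Finset.sum_ite_eq']
  obtain ⟨m, hm⟩ := heven u
  rw [hm, add_smul, CharTwo.add_self_eq_zero, zero_add]
  simp [hu]

end Hypergraph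

namespace EmbeddedGraph

variable {Φ : Type*} (Γ : EmbeddedGraph Φ)

/-- The rank-3 edge at a vertex of an inserted face. -/
def triangleAt : Φ ⊕ Γ.toColex.EdgeOf 2 → Set (Φ ⊕ Γ.toColex.EdgeOf 2) :=
  Sum.elim (fun _ => ∅) (Quot.lift Γ.triangle (by
    rintro a b (h : b = Γ.t2 a)
    rw [h, triangle_t2]))

theorem triangleAt_tip (a : Φ) : Γ.triangleAt (Γ.tip a) = Γ.triangle a := rfl

/-- The vertices of the inserted faces that lie on rank-3 edges of `σ`. -/
def tips (σ : Set (Set (Φ ⊕ Γ.toColex.EdgeOf 2))) : Set (Φ ⊕ Γ.toColex.EdgeOf 2) :=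
  {v | ∃ a, v = Γ.tip a ∧ Γ.triangle a ∈ σ}

theorem injOn_triangleAt (σ : Set (Set (Φ ⊕ Γ.toColex.EdgeOf 2))) :
    Set.InjOn Γ.triangleAt (Γ.tips σ) := by
  rintro _ ⟨a, rfl, -⟩ _ ⟨b, rfl, -⟩ h
  have h' : Γ.triangle a = Γ.triangle b := h
  have ha : Γ.tip a ∈ Γ.triangle b := h' ▸ Γ.tip_mem_triangle a
  rcases ha with h | h | h
  · cases h
  · cases h
  · exact h

theorem ncard_tips_le [Finite Φ] (σ : Set (Set (Φ ⊕ Γ.toColex.EdgeOf 2))) :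
    (Γ.tips σ).ncard ≤ {e ∈ σ | e.ncard = 3}.ncard := by
  refine Set.ncard_le_ncard_of_injOn Γ.triangleAt ?_ (Γ.injOn_triangleAt σ) (Set.toFinite _)
  rintro _ ⟨a, rfl, ha⟩
  exact ⟨ha, Γ.ncard_triangle a⟩

/-- On the centralizer of the gauge group, the commutation of the operator of an edge depends only on the
vertex of the inserted face: rank-2 edges commute, and on a rank-3 edge the three signs agree. -/
theorem symplecticForm_edge [Finite Φ] (hdeg : ∀ v : Γ.Vertex, 2 < Γ.degree v)
    {col : Set (Φ ⊕ Γ.toColex.EdgeOf 2) → PauliLetter}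
    (hcol : Γ.subsystemHypergraph.IsLinkColouring col)
    {y : Φ ⊕ Γ.toColex.EdgeOf 2 → ZMod 2 × ZMod 2}
    (hy : y ∈ SubsystemCode.space
      (SubsystemCode.centralizer (Γ.subsystemHypergraph.gaugeGroup col))) :
    (∀ e ∈ Γ.subsystemHypergraph.edgeSet, (∀ a, e ≠ Γ.triangle a) →
      symplecticForm _ (Pauli.on (col e) e).vec y = 0) ∧
    ∀ a, symplecticForm _ (Pauli.on (col (Γ.triangle a)) (Γ.triangle a)).vec y =
      (y (Γ.tip a)).1 := by
  classical
  rw [Hypergraph.vec_mem_centralizer_iff] at hy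
  have hpair : ∀ u v, u ≠ v → ({u, v} : Set _) ∈ Γ.subsystemHypergraph.edgeSet →
      symplecticForm _ (Pauli.on (col {u, v}) {u, v}).vec y = 0 := by
    intro u v huv he
    rw [Pauli.symplecticForm_on_pair _ huv, hy _ he u (Or.inl rfl) v (Or.inr rfl)]
    exact CharTwo.add_self_eq_zero _
  constructor
  · intro e he hne
    rcases (Γ.mem_edgeSet_iff e).1 he with ⟨a, rfl⟩ | ⟨a, rfl⟩ | ⟨a, rfl⟩ | ⟨a, rfl⟩
    · exact hpair _ _ (fun h => Γ.ne0 a (Sum.inl_injective h).symm) he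
    · exact hpair _ _ (fun h => Γ.ne1 a (Sum.inl_injective h).symm) he
    · exact absurd rfl (hne a)
    · exact hpair _ _ (Γ.tip_t1_ne hdeg a).symm he
  · intro a
    have ht := hy _ (Γ.triangle_mem a)
    have hZ := hcol.2.1 _ (Γ.triangle_mem a) (Γ.ncard_triangle a)
    have h1 := ht _ (Γ.inl_mem_triangle a) _ (Γ.tip_mem_triangle a)
    have h2 := ht _ (Or.inr (Or.inl rfl) : Sum.inl (Γ.t2 a) ∈ Γ.triangle a) _
      (Γ.tip_mem_triangle a)
    rw [hZ, PauliLetter.charge_Z, PauliLetter.charge_Z] at h1 h2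
    have hset : Finset.univ.filter (fun v => v ∈ Γ.triangle a) =
        {Sum.inl a, Sum.inl (Γ.t2 a), Γ.tip a} := by
      ext v
      simp [triangle]
    have hn1 : (Sum.inl a : Φ ⊕ Γ.toColex.EdgeOf 2) ∉
        ({Sum.inl (Γ.t2 a), Γ.tip a} : Finset (Φ ⊕ Γ.toColex.EdgeOf 2)) := by
      simp [tip, (Γ.ne2 a).symm]
    have hn2 : (Sum.inl (Γ.t2 a) : Φ ⊕ Γ.toColex.EdgeOf 2) ≠ Γ.tip a := fun h => nomatch h
    rw [Pauli.symplecticForm_on, hZ]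
    simp only [PauliLetter.charge_Z]
    rw [show (∑ v with v ∈ Γ.triangle a, (y v).1) =
      ∑ v ∈ {Sum.inl a, Sum.inl (Γ.t2 a), Γ.tip a}, (y v).1 by rw [← hset],
      Finset.sum_insert hn1, Finset.sum_pair hn2, h1, h2, ← add_assoc, CharTwo.add_self_eq_zero,
      zero_add]

/-- Up to the gauge group, the operator of a hypercycle is a product of `Z` at the vertices of inserted
faces, so both commute in the same way with the centralizer. -/
theorem symplecticForm_cycleOperator [Finite Φ] (hdeg : ∀ v : Γ.Vertex, 2 < Γ.degree v)
    {col : Set (Φ ⊕ Γ.toColex.EdgeOf 2) → PauliLetter}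
    (hcol : Γ.subsystemHypergraph.IsLinkColouring col)
    {σ : Set (Set (Φ ⊕ Γ.toColex.EdgeOf 2))} (hσ : σ ⊆ Γ.subsystemHypergraph.edgeSet)
    {y : Φ ⊕ Γ.toColex.EdgeOf 2 → ZMod 2 × ZMod 2}
    (hy : y ∈ SubsystemCode.space
      (SubsystemCode.centralizer (Γ.subsystemHypergraph.gaugeGroup col))) :
    symplecticForm _ (Hypergraph.cycleOperator col σ).vec y =
      symplecticForm _ (Pauli.on PauliLetter.Z (Γ.tips σ)).vec y := by
  classical
  obtain ⟨h2, h3⟩ := Γ.symplecticForm_edge hdeg hcol hy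
  rw [Hypergraph.vec_cycleOperator, map_sum, LinearMap.sum_apply, Pauli.symplecticForm_on]
  symm
  refine Finset.sum_of_injOn Γ.triangleAt ?_ ?_ ?_ ?_
  · intro v hv w hw h
    simp only [Finset.coe_filter, Finset.mem_univ, true_and, Set.mem_ofPred_eq] at hv hw
    exact Γ.injOn_triangleAt σ hv hw h
  · intro v hv
    simp only [Finset.coe_filter, Finset.mem_univ, true_and, Set.mem_ofPred_eq] at hv
    obtain ⟨a, rfl, ha⟩ := hv
    rw [triangleAt_tip, Set.Finite.coe_toFinset]
    exact ha
  · intro e he hne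
    have heσ : e ∈ σ := (Set.toFinite σ).mem_toFinset.1 he
    refine h2 e (hσ heσ) ?_
    rintro a rfl
    refine hne ⟨Γ.tip a, ?_, rfl⟩
    simp only [Finset.coe_filter, Finset.mem_univ, true_and, Set.mem_ofPred_eq]
    exact ⟨a, rfl, heσ⟩
  · intro v hv
    obtain ⟨a, rfl, ha⟩ := (Finset.mem_filter.1 hv).2
    rw [triangleAt_tip, h3, PauliLetter.charge_Z]

theorem distance_le [Finite Φ] (hdeg : ∀ v : Γ.Vertex, 2 < Γ.degree v)
    {col : Set (Φ ⊕ Γ.toColex.EdgeOf 2) → PauliLetter}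
    (hcol : Γ.subsystemHypergraph.IsLinkColouring col)
    {σ : Set (Set (Φ ⊕ Γ.toColex.EdgeOf 2))}
    (hσ : Γ.subsystemHypergraph.IsNontrivialHypercycle col σ) :
    SubsystemCode.distance (Γ.subsystemHypergraph.gaugeGroup col) ≤
      ({e ∈ σ | e.ncard = 3}.ncard : ℕ∞) := by
  obtain ⟨hcyc, hnot⟩ := hσ
  have hG := Γ.subsystemHypergraph.scalarI_mem_gaugeGroup col
  have hW := Hypergraph.vec_cycleOperator_mem hcol hcyc
  have hform := fun y hy => Γ.symplecticForm_cycleOperator hdeg hcol hcyc.1 (y := y) hy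
  set G := Γ.subsystemHypergraph.gaugeGroup col
  set W := Hypergraph.cycleOperator col σ
  let p : Pauli (Φ ⊕ Γ.toColex.EdgeOf 2) := Pauli.on PauliLetter.Z (Γ.tips σ)
  have hp : p ∉ G := by
    rw [← SubsystemCode.vec_mem_space_iff hG, SubsystemCode.mem_space_iff]
    intro h
    have hWG : W.vec ∈ SubsystemCode.space G := by
      rw [SubsystemCode.mem_space_iff]
      intro y hy
      rw [symplecticForm_comm, hform y hy, symplecticForm_comm]
      exact h y hy
    have hWS : W.vec ∈ SubsystemCode.space (SubsystemCode.stabilizer G) := by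
      rw [SubsystemCode.space_stabilizer hG]
      exact ⟨hWG, hW⟩
    have hS : Pauli.scalarI ∈ SubsystemCode.stabilizer G :=
      ⟨hG, SubsystemCode.mem_centralizer_iff.2 fun q _ => by
        simp [symplecticForm_apply, Pauli.vec, Pauli.scalarI, PauliLetter.vec]⟩
    exact hnot ((SubsystemCode.vec_mem_space_iff hS).1 hWS)
  have hpC : p ∈ SubsystemCode.centralizer (SubsystemCode.stabilizer G) := by
    rw [SubsystemCode.mem_centralizer_iff]
    intro q hq
    have hqC : q.vec ∈ SubsystemCode.space (SubsystemCode.centralizer G) := ⟨q, hq.2, rfl⟩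
    rw [symplecticForm_comm, ← hform _ hqC, symplecticForm_comm]
    rw [SubsystemCode.space_centralizer] at hW
    exact hW _ ⟨q, hq.1, rfl⟩
  refine (iInf₂_le p ⟨hpC, hp⟩).trans ?_
  have hw : p.weight = (Γ.tips σ).ncard := Pauli.weight_on (by decide) _
  rw [hw]
  exact_mod_cast Γ.ncard_tips_le σ

end EmbeddedGraph

theorem theorem3 {Φ : Type*} [Finite Φ] (Γ : EmbeddedGraph Φ) (hloop : Γ.Loopless)
    (hdeg : ∀ v : Γ.Vertex, Even (Γ.degree v) ∧ 2 < Γ.degree v) :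
    (∃ col, Γ.subsystemHypergraph.IsLinkColouring col) ∧
    ∀ col, Γ.subsystemHypergraph.IsLinkColouring col →
      SubsystemCode.IsTwoLocal (Γ.subsystemHypergraph.gaugeGroup col) ∧
      (∃ k r : ℕ,
        (k : ℤ) = 1 + Γ.dualBipartiteIndicator - Γ.eulerChar ∧
        (r : ℤ) = 4 * (Γ.numEdges : ℤ) - Γ.eulerChar ∧
        SubsystemCode.HasParameters (Γ.subsystemHypergraph.gaugeGroup col)
          (6 * Γ.numEdges) k r) ∧
      ∀ σ : Set (Set (Φ ⊕ Γ.toColex.EdgeOf 2)),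
        Γ.subsystemHypergraph.IsNontrivialHypercycle col σ →
          SubsystemCode.distance (Γ.subsystemHypergraph.gaugeGroup col) ≤
            ({e ∈ σ | e.ncard = 3}.ncard : ℕ∞) := by
  have hdeg2 : ∀ v : Γ.Vertex, 2 < Γ.degree v := fun v => (hdeg v).2
  constructor
  · obtain ⟨col, p, q, h⟩ := Γ.exists_colourData hloop hdeg
    exact ⟨col, h.isLinkColouring⟩
  · intro col hcol
    obtain ⟨p, q, hc⟩ := Γ.exists_colourData_of_isLinkColouring hloop hdeg2 hcol
    exact ⟨Hypergraph.isTwoLocal_gaugeGroup _ hcol.1, Γ.exists_hasParameters hc,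
      fun σ hσ => Γ.distance_le hdeg2 hcol hσ⟩
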